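/- Let $u>0$ be real and consider the Painlevé I spectral curve on $\mathbb{P}^1$, $$x(z)=z^2-2u,\qquad y(z)=z^3-3uz,\qquad \omega_{0,2}(z_1,z_2)=\frac{dz_1\,dz_2}{(z_1-z_2)^2},$$ whose only ramification point is $z=0$, with Galois involution $z\mapsto -z$. For $i\ge 0$ put $$\theta(z)=\frac{-2}{(y(z)-y(-z))\,dx(z)}=\Bigl(\sum_{m\ge 0}\theta_m z^{2m-2}\Bigr)\frac1{dz},\qquad e_i(z)=\frac{z^{2i+1}}{(2i+1)!!},\qquad \xi^i(z)=\operatorname*{Res}_{w=0}\Bigl(\int_0^w\omega_{0,2}(z,\cdot)\Bigr)\frac{(2i+1)!!}{w^{2i+2}}\,dw,$$ and let $$A_{i,j,k}=\operatorname*{Res}_{z=0}\theta e_i\,de_j\,de_k,\quad B_{i,j}^k=\operatorname*{Res}_{z=0}\theta e_i\,de_j\,\xi^k,\quad C_i^{j,k}=\operatorname*{Res}_{z=0}\theta e_i\,\xi^j\xi^k,\quad D_i=\delta_{i,0}\frac{\theta_1}{8}+\delta_{i,1}\frac{\theta_0}{24}$$ be the associated quantum Airy structure. Its amplitudes $F^{\mathrm{PI}}_{g;k_1,\dots,k_n}(u)$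 ($g\ge 0$, $n\ge 1$, $k_i\ge 0$) are determined by $F_{0;i}=F_{0;i,j}=0$, $F_{0;i,j,k}=A_{i,j,k}$, $F_{1;i}=D_i$ and, for all other $(g,n)$ with $2g-2+n>0$, $$F_{g;k_1,\dots,k_n}=\sum_{m=2}^n\sum_{\mu\ge 0}B_{k_1,k_m}^{\mu}F_{g;\mu,k_2,\dots,\widehat{k_m},\dots,k_n}+\frac12\sum_{\mu,\nu\ge 0}C_{k_1}^{\mu,\nu}\Bigl(F_{g-1;\mu,\nu,k_2,\dots,k_n}+\sum_{\substack{g_1+g_2=g\\ I_1\sqcup I_2=\{k_2,\dots,k_n\}}}F_{g_1;\mu,I_1}F_{g_2;\nu,I_2}\Bigr)$$ (terms with $g-1<0$ are zero; the sums over $\mu,\nu$ have finitely many nonzero terms). For $n=0$ and $g\ge 2$, $F^{\mathrm{PI}}_g(u)$ is the free energy $$F_g=\frac{1}{2-2g}\operatorname*{Res}_{z=0}\Bigl(\int_0^z y\,dx\Bigr)\sum_{i\ge 0}F_{g;i}\,\xi^i(z).$$ Define $$P(u)=\begin{cases}\dfrac{2}{5u^2}&\text{if }u<\tfrac25,\\[2mm]\dfrac{5}{10u-2}&\text{if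 }u\ge\tfrac25.\end{cases}$$ Then for every $u>0$ we have $P(u)>0$ and there is a constant $S(u)>0$, depending only on $u$, such that for all integers $g,n\ge 0$ with $2g-2+n>0$ and all integers $k_1,\dots,k_n\ge 0$, $$F^{\mathrm{PI}}_{g;k_1,\dots,k_n}(u)\prod_{i=1}^n(2k_i+1)!!\;\le\; S(u)\Bigl(\frac{2u}{27}\Bigr)^{g}P(u)^{3g-3+n}\,\frac{(3g-3+n)!}{g!}.$$ -/

import Mathlib

open scoped LaurentSeries PowerSeries Nat

/-- Tensors `(A, B, C, D)` of a quantum Airy structure on the vector space with basis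
`(e_i)_{i ≥ 0}`; `B i j k` is `B_{i,j}^k` and `C i j k` is `C_i^{j,k}`. -/
structure AiryTensors (K : Type*) where
  A : ℕ → ℕ → ℕ → K
  B : ℕ → ℕ → ℕ → K
  C : ℕ → ℕ → ℕ → K
  D : ℕ → K

/-- All ways to distribute the entries of a list over two lists (one for each subset of positions),
that is, the ordered decompositions `I₁ ⊔ I₂` of the family of entries. -/
def listSplits {α : Type*} : List α → List (List α × List α)
  | [] => [([], [])]
  | a :: l => (listSplits l).map (fun s => (a :: s.1, s.2)) ++
      (listSplits l).map (fun s => (s.1, a :: s.2))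

theorem length_of_mem_listSplits {α : Type*} {l : List α} {s : List α × List α}
    (h : s ∈ listSplits l) : s.1.length + s.2.length = l.length := by
  induction l generalizing s with
  | nil => simp_all [listSplits]
  | cons a l ih =>
    simp only [listSplits, List.mem_append, List.mem_map] at h
    rcases h with ⟨t, ht, rfl⟩ | ⟨t, ht, rfl⟩ <;>
      · have := ih ht
        simp only [List.length_cons]
        omega

namespace AiryTensors

/-- The amplitudes `F_{g;i₁,…,iₙ}`, `n ≥ 1`, of a quantum Airy structure, defined by recursion on
`2g - 2 + n`. The guard `2 < 2 g' + n'` in the product terms leaves out factors with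
`(g',n') = (0,1), (0,2)`, which vanish; see `amplitude_rec` for the recursion without guards.
The value at the empty list is a dummy: free energies (`n = 0`) are defined separately. -/
noncomputable def amplitude {K : Type*} [Field K] (Q : AiryTensors K) : ℕ → List ℕ → K
  | _, [] => 0
  | 0, [_] => 0
  | 0, [_, _] => 0
  | 0, [i, j, k] => Q.A i j k
  | 1, [i] => Q.D i
  | g, i :: l =>
    (∑ m : Fin l.length, ∑ᶠ μ : ℕ, Q.B i (l.get m) μ * Q.amplitude g (μ :: l.eraseIdx m)) +
    1 / 2 * ∑ᶠ p : ℕ × ℕ, Q.C i p.1 p.2 *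
      ((if _h : 0 < g then Q.amplitude (g - 1) (p.1 :: p.2 :: l) else 0) +
        ∑ q : Finset.HasAntidiagonal.antidiagonal g, ((listSplits l).attach.map (fun s =>
          if _h : 2 < 2 * q.1.1 + (s.1.1.length + 1) ∧ 2 < 2 * q.1.2 + (s.1.2.length + 1) then
            Q.amplitude q.1.1 (p.1 :: s.1.1) * Q.amplitude q.1.2 (p.2 :: s.1.2)
          else 0)).sum)
termination_by g l => 2 * g + l.length
decreasing_by
  · have := m.2
    simp only [List.length_cons, List.length_eraseIdx, this, if_true]
    omega
  · simp only [List.length_cons]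
    omega
  · have h1 := length_of_mem_listSplits s.2
    have h2 := Finset.HasAntidiagonal.mem_antidiagonal.mp q.2
    simp only [List.length_cons]
    omega
  · have h1 := length_of_mem_listSplits s.2
    have h2 := Finset.HasAntidiagonal.mem_antidiagonal.mp q.2
    simp only [List.length_cons]
    omega

variable {K : Type*} [Field K] (Q : AiryTensors K)

theorem amplitude_eq_zero_of_unstable (g : ℕ) (l : List ℕ) (h : 2 * g + l.length ≤ 2) :
    Q.amplitude g l = 0 := by
  match g, l, h with
  | _, [], _ => simp [amplitude]
  | 0, [_], _ => simp [amplitude]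
  | 0, [_, _], _ => simp [amplitude]
  | 0, _ :: _ :: _ :: _, h => simp at h
  | g + 1, _ :: _, h => simp at h; omega

/-- The recursion for the amplitudes in its usual form. -/
theorem amplitude_rec (g i : ℕ) (l : List ℕ) (h : 2 < 2 * g + (i :: l).length)
    (h03 : ¬(g = 0 ∧ l.length = 2)) (h11 : ¬(g = 1 ∧ l.length = 0)) :
    Q.amplitude g (i :: l) =
      (∑ m : Fin l.length, ∑ᶠ μ : ℕ, Q.B i (l.get m) μ * Q.amplitude g (μ :: l.eraseIdx m)) +
      1 / 2 * ∑ᶠ p : ℕ × ℕ, Q.C i p.1 p.2 *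
        ((if 0 < g then Q.amplitude (g - 1) (p.1 :: p.2 :: l) else 0) +
          ∑ q ∈ Finset.HasAntidiagonal.antidiagonal g, ((listSplits l).map (fun s =>
            Q.amplitude q.1 (p.1 :: s.1) * Q.amplitude q.2 (p.2 :: s.2))).sum) := by
  rw [amplitude]
  · congr 2
    refine finsum_congr fun p => ?_
    congr 2
    rw [← Finset.sum_coe_sort (Finset.HasAntidiagonal.antidiagonal g)]
    refine Finset.sum_congr rfl fun q _ => ?_
    conv_rhs => rw [← List.attach_map_subtype_val (listSplits l), List.map_map]
    congr 1
    refine List.map_congr_left fun s _ => ?_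
    simp only [Function.comp]
    split_ifs with hs
    · rfl
    · rw [not_and_or] at hs
      rcases hs with hs | hs
      · rw [amplitude_eq_zero_of_unstable Q _ (p.1 :: s.1.1) (by simpa using hs), zero_mul]
      · rw [amplitude_eq_zero_of_unstable Q _ (p.2 :: s.1.2) (by simpa using hs), mul_zero]
  all_goals
    intros
    subst_vars
    simp_all

end AiryTensors

/-- The primitive `∫₀^X f` of a formal power series. -/
noncomputable def primitive {R : Type*} [Field R] (f : R⟦X⟧) : R⟦X⟧ :=
  PowerSeries.mk fun n => if n = 0 then 0 else PowerSeries.coeff (n - 1) f / n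

/-- The residue at `ζ = 0` of the 1-form `f dζ`. -/
def residue {K : Type*} [Field K] (f : K⸨X⸩) : K := f.coeff (-1)

/-- The expansion of a spectral curve with a single (simple) ramification point, at that point, in
the local coordinate `ζ` for which `x = x₀ + ζ²`. The bidifferential is
`ω_{0,2} = (1 / (ζ₁ - ζ₂)² + ∑ b m₁ m₂ ζ₁^{m₁} ζ₂^{m₂}) dζ₁ dζ₂`. -/
structure OnePointCurve (K : Type*) [Field K] where
  x₀ : K
  y : K⟦X⟧
  b : ℕ → ℕ → K
  b_symm : ∀ m₁ m₂, b m₁ m₂ = b m₂ m₁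

namespace OnePointCurve

variable {K : Type*} [Field K] (S : OnePointCurve K)

noncomputable def x : K⟦X⟧ := PowerSeries.C S.x₀ + PowerSeries.X ^ 2

/-- `θ = -2 / ((y(ζ) - y(σ(ζ))) dx(ζ))` with `σ(ζ) = -ζ`, as the coefficient of `1 / dζ`. -/
noncomputable def theta : K⸨X⸩ :=
  -2 / (((S.y - PowerSeries.evalNegHom S.y) * PowerSeries.derivative K S.x : K⟦X⟧) : K⸨X⸩)

/-- The coefficients in `θ = (∑ θ_m ζ^{2m-2}) / dζ`. -/
noncomputable def thetaCoeff (m : ℕ) : K := S.theta.coeff (2 * (m : ℤ) - 2)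

/-- The even coefficients `φ_{m₁,m₂}` of the regular part of `ω_{0,2}`. -/
def phi (m₁ m₂ : ℕ) : K := S.b (2 * m₁) (2 * m₂)

/-- `ω_{0,2}(z, w) / (dz dw)`, expanded at `w = 0` with coefficients Laurent series in `z`. -/
noncomputable def omega02 : K⸨X⸩⟦X⟧ :=
  ((PowerSeries.C (HahnSeries.single (1 : ℤ) (1 : K)) - PowerSeries.X) ^ 2)⁻¹ +
    PowerSeries.mk fun m₂ => ((PowerSeries.mk fun m₁ => S.b m₁ m₂ : K⟦X⟧) : K⸨X⸩)

/-- `ξ^i(z) = Res_{w = 0} (∫₀^w ω_{0,2}(z, ·)) (2i+1)!! / w^{2i+2} dw`, as the coefficient of `dz`;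
the residue in `w` is the coefficient of `w^{2i+1}` of the primitive times `(2i+1)!!`. -/
noncomputable def xi (i : ℕ) : K⸨X⸩ :=
  PowerSeries.coeff (2 * i + 1) (primitive S.omega02) * (((2 * i + 1)‼ : ℕ) : K⸨X⸩)

/-- `e_i = ζ^{2i+1} / (2i+1)!!`. -/
noncomputable def e (K : Type*) [Field K] (i : ℕ) : K⟦X⟧ :=
  PowerSeries.monomial (2 * i + 1) (1 / (((2 * i + 1)‼ : ℕ) : K))

/-- `d e_i`, as the coefficient of `dζ`. -/
noncomputable def de (K : Type*) [Field K] (i : ℕ) : K⟦X⟧ := PowerSeries.derivative K (e K i)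

/-- The quantum Airy structure of the spectral curve. -/
noncomputable def airy : AiryTensors K where
  A i j k := residue (S.theta * (e K i : K⸨X⸩) * (de K j : K⸨X⸩) * (de K k : K⸨X⸩))
  B i j k := residue (S.theta * (e K i : K⸨X⸩) * (de K j : K⸨X⸩) * S.xi k)
  C i j k := residue (S.theta * (e K i : K⸨X⸩) * S.xi j * S.xi k)
  D i := (if i = 0 then S.thetaCoeff 0 / 2 * S.phi 0 0 + S.thetaCoeff 1 / 8 else 0) +
    (if i = 1 then S.thetaCoeff 0 / 24 else 0)

/-- The correlator `ω_{g,1} = ∑ F_{g;i} ξ^i`, as the coefficient of `dz`. -/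
noncomputable def omega1 (g : ℕ) : K⸨X⸩ := ∑ᶠ i : ℕ, S.airy.amplitude g [i] • S.xi i

/-- The free energy `F_g = 1 / (2 - 2g) · Res_{z = 0} (∫₀^z y dx) ω_{g,1}(z)`, `g ≥ 2`. -/
noncomputable def freeEnergy (g : ℕ) : K :=
  1 / (2 - 2 * (g : K)) *
    residue ((primitive (S.y * PowerSeries.derivative K S.x) : K⸨X⸩) * S.omega1 g)

/-- The amplitudes `F_{g;k₁,…,kₙ}` of the spectral curve, including the free energies `F_g` for
`n = 0`. -/
noncomputable def F (g : ℕ) {n : ℕ} (k : Fin n → ℕ) : K :=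
  if n = 0 then S.freeEnergy g else S.airy.amplitude g (List.ofFn k)

end OnePointCurve

/-- The Painlevé I spectral curve `x = z² - 2u`, `y = z³ - 3uz`, `ω_{0,2} = dz₁ dz₂ / (z₁ - z₂)²`
on the projective line, whose only ramification point is `z = 0`, with `ζ = z`. -/
noncomputable def painleveI {K : Type*} [Field K] (u : K) : OnePointCurve K where
  x₀ := -2 * u
  y := PowerSeries.X ^ 3 - PowerSeries.C (3 * u) * PowerSeries.X
  b _ _ := 0
  b_symm _ _ := rfl

/-- The exponential growth rate `P(u)`. -/
noncomputable def growthP (u : ℝ) : ℝ :=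
  if u < 2 / 5 then 2 / (5 * u ^ 2) else 5 / (10 * u - 2)


/-!
The Painlevé I curve has `1 / θ(z) = (6 u z² - 2 z⁴) dz`, so `6 u θ_m - 2 θ_{m-1} = δ_{m,0}`.
Combining the recursions for the first indices `i` and `i + 1` accordingly collapses the sums over
`μ, ν`: the normalised amplitudes `G = F ∏ (2kᵢ + 1)!!` satisfy the Virasoro constraints
`6 u G_{g;i,K} = 2 G_{g;i+1,K} + (i merged with an entry of K) + ½ (quadratic part) + (seed)`,
all of whose terms are nonnegative. The commutation relations of the constraints with `i = 0` and
`i = 1` (the string and dilaton equations) carry these two over from the first index to any other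
one, where they have no quadratic part. So an index `0` or `1` among the remaining ones can be
removed, and if there is none, the constraint at the first index involves positive genera only. With
`t = 1 / (6 u)` and `j = 3 h + n - ∑ kᵢ`, induction bounds an amplitude of genus `h + 1` by
`(9/4)^h t^(2h+n+j) (6/5)^j 3^n (2h+n+j)! / j!`.
For `u ≥ 2/5` the binomial series at `6 t / 5 = 1 / (5 u)` bounds this uniformly in `j`, whence
`P(u) = 5 / (10 u - 2)`. For `u < 2/5` the bound scales like `u^(-(2h+n+j))`, and `j ≤ 3 h + n`
gives `P(u)` proportional to `u⁻²`.
-/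

section MultisetSums

variable {α M : Type*} [AddCommMonoid M]

/-- The sum of `f k (K \ {k})` over the entries `k` of the multiset `K`. -/
def eraseSum [DecidableEq α] (K : Multiset α) (f : α → Multiset α → M) : M :=
  (K.map fun k => f k (K.erase k)).sum

/-- The sum of `f I J` over the ordered decompositions `K = I + J`. -/
def splitSum (K : Multiset α) (f : Multiset α → Multiset α → M) : M :=
  (K.antidiagonal.map fun s => f s.1 s.2).sum

section Erase

variable [DecidableEq α]

@[simp] theorem eraseSum_zero (f : α → Multiset α → M) : eraseSum 0 f = 0 := by simp [eraseSum]

theorem eraseSum_cons (a : α) (K : Multiset α) (f : α → Multiset α → M) :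
    eraseSum (a ::ₘ K) f = f a K + eraseSum K fun k L => f k (a ::ₘ L) := by
  simp only [eraseSum, Multiset.map_cons, Multiset.sum_cons, Multiset.erase_cons_head]
  congr 2
  refine Multiset.map_congr rfl fun k hk => ?_
  rw [Multiset.erase_cons_tail_of_mem hk]

theorem eraseSum_congr {K : Multiset α} {f f' : α → Multiset α → M}
    (h : ∀ k L, k ::ₘ L = K → f k L = f' k L) : eraseSum K f = eraseSum K f' :=
  congrArg Multiset.sum (Multiset.map_congr rfl fun _ hk => h _ _ (Multiset.cons_erase hk))

@[simp] theorem eraseSum_const_zero (K : Multiset α) : eraseSum K (fun _ _ => (0 : M)) = 0 := by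
  simp [eraseSum]

theorem eraseSum_eq_zero {K : Multiset α} {f : α → Multiset α → M}
    (h : ∀ k L, k ::ₘ L = K → f k L = 0) : eraseSum K f = 0 := by
  rw [eraseSum_congr h, eraseSum_const_zero]

theorem eraseSum_add (K : Multiset α) (f f' : α → Multiset α → M) :
    eraseSum K (fun k L => f k L + f' k L) = eraseSum K f + eraseSum K f' :=
  Multiset.sum_map_add

theorem eraseSum_sum {ι : Type*} (K : Multiset α) (s : Finset ι) (f : ι → α → Multiset α → M) :
    eraseSum K (fun k L => ∑ i ∈ s, f i k L) = ∑ i ∈ s, eraseSum K (f i) := by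
  classical
  induction s using Finset.induction_on with
  | empty => simp
  | insert a s ha ih => simp only [Finset.sum_insert ha, eraseSum_add, ih]

theorem eraseSum_comm (K : Multiset α) (f : α → α → Multiset α → M) :
    eraseSum K (fun k L => eraseSum L fun l N => f k l N) =
      eraseSum K (fun k L => eraseSum L fun l N => f l k N) := by
  induction K using Multiset.induction_on generalizing f with
  | empty => simp
  | cons a K ih =>
    simp only [eraseSum_cons, eraseSum_add]
    rw [ih fun k l N => f k l (a ::ₘ N), add_left_comm]

theorem eraseSum_mul_left {R : Type*} [NonUnitalNonAssocSemiring R] (K : Multiset α) (c : R)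
    (f : α → Multiset α → R) : eraseSum K (fun k L => c * f k L) = c * eraseSum K f :=
  Multiset.sum_map_mul_left

end Erase

@[simp] theorem splitSum_zero (f : Multiset α → Multiset α → M) : splitSum 0 f = f 0 0 := by
  simp [splitSum]

theorem splitSum_cons (a : α) (K : Multiset α) (f : Multiset α → Multiset α → M) :
    splitSum (a ::ₘ K) f =
      splitSum K (fun I J => f (a ::ₘ I) J) + splitSum K (fun I J => f I (a ::ₘ J)) := by
  simp [splitSum, Multiset.antidiagonal_cons, Multiset.map_map, add_comm]

theorem splitSum_congr {K : Multiset α} {f f' : Multiset α → Multiset α → M}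
    (h : ∀ I J, I + J = K → f I J = f' I J) : splitSum K f = splitSum K f' :=
  congrArg Multiset.sum
    (Multiset.map_congr rfl fun _ hs => h _ _ (Multiset.mem_antidiagonal.mp hs))

@[simp] theorem splitSum_const_zero (K : Multiset α) : splitSum K (fun _ _ => (0 : M)) = 0 := by
  simp [splitSum]

theorem splitSum_add (K : Multiset α) (f f' : Multiset α → Multiset α → M) :
    splitSum K (fun I J => f I J + f' I J) = splitSum K f + splitSum K f' :=
  Multiset.sum_map_add

theorem splitSum_sum {ι : Type*} (K : Multiset α) (s : Finset ι)
    (f : ι → Multiset α → Multiset α → M) :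
    splitSum K (fun I J => ∑ i ∈ s, f i I J) = ∑ i ∈ s, splitSum K (f i) := by
  classical
  induction s using Finset.induction_on with
  | empty => simp
  | insert a s ha ih => simp only [Finset.sum_insert ha, splitSum_add, ih]

theorem splitSum_mul_left {R : Type*} [NonUnitalNonAssocSemiring R] (K : Multiset α) (c : R)
    (f : Multiset α → Multiset α → R) : splitSum K (fun I J => c * f I J) = c * splitSum K f :=
  Multiset.sum_map_mul_left

theorem splitSum_swap (K : Multiset α) (f : Multiset α → Multiset α → M) :
    splitSum K (fun I J => f J I) = splitSum K f := by
  induction K using Multiset.induction_on generalizing f with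
  | empty => simp
  | cons a K ih =>
    simp only [splitSum_cons]
    rw [ih fun I J => f I (a ::ₘ J), ih fun I J => f (a ::ₘ I) J, add_comm]

theorem splitSum_eraseSum_left [DecidableEq α] (K : Multiset α)
    (f : α → Multiset α → Multiset α → M) :
    splitSum K (fun I J => eraseSum I fun k I' => f k I' J) =
      eraseSum K (fun k L => splitSum L fun I J => f k I J) := by
  induction K using Multiset.induction_on generalizing f with
  | empty => simp
  | cons a K ih =>
    simp only [eraseSum_cons, splitSum_cons, splitSum_add, eraseSum_add]
    rw [ih fun k I J => f k (a ::ₘ I) J, ih fun k I J => f k I (a ::ₘ J), add_assoc]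

theorem splitSum_ite_eq_zero [DecidableEq α] (K : Multiset α) (f : Multiset α → M) :
    splitSum K (fun I J => if I = 0 then f J else 0) = f K := by
  induction K using Multiset.induction_on generalizing f with
  | empty => simp
  | cons a K ih => simp [splitSum_cons, ih fun J => f (a ::ₘ J)]

theorem splitSum_ite_eq_singleton [DecidableEq α] (a : α) (K : Multiset α)
    (f : Multiset α → M) :
    splitSum K (fun I J => if I = {a} then f J else 0) =
      eraseSum K fun k L => if k = a then f L else 0 := by
  induction K using Multiset.induction_on generalizing f with
  | empty => simp
  | cons b K ih =>
    rw [splitSum_cons, eraseSum_cons, ih fun J => f (b ::ₘ J)]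
    simp only [eq_comm (b := ({a} : Multiset α)), Multiset.singleton_eq_cons_iff]
    by_cases h : b = a
    · simp [h, splitSum_ite_eq_zero]
    · simp [h, Ne.symm h]

theorem cons_eq_pair_self_iff {a b : α} {I : Multiset α} :
    b ::ₘ I = {a, a} ↔ b = a ∧ I = {a} := by
  constructor
  · intro h
    obtain rfl : b = a := by
      have hb : b ∈ ({a, a} : Multiset α) := h ▸ Multiset.mem_cons_self b I
      simpa using hb
    exact ⟨rfl, (Multiset.cons_inj_right b).mp h⟩
  · rintro ⟨rfl, rfl⟩
    rfl

section Ordered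

variable [PartialOrder M] [IsOrderedAddMonoid M]

theorem eraseSum_mono [DecidableEq α] {K : Multiset α} {f f' : α → Multiset α → M}
    (h : ∀ k L, k ::ₘ L = K → f k L ≤ f' k L) : eraseSum K f ≤ eraseSum K f' :=
  Multiset.sum_map_le_sum_map _ _ fun _ hk => h _ _ (Multiset.cons_erase hk)

theorem splitSum_mono {K : Multiset α} {f f' : Multiset α → Multiset α → M}
    (h : ∀ I J, I + J = K → f I J ≤ f' I J) : splitSum K f ≤ splitSum K f' :=
  Multiset.sum_map_le_sum_map _ _ fun _ hs => h _ _ (Multiset.mem_antidiagonal.mp hs)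

theorem eraseSum_nonneg [DecidableEq α] {K : Multiset α} {f : α → Multiset α → M}
    (h : ∀ k L, k ::ₘ L = K → 0 ≤ f k L) : 0 ≤ eraseSum K f := by
  simpa using eraseSum_mono h

theorem splitSum_nonneg {K : Multiset α} {f : Multiset α → Multiset α → M}
    (h : ∀ I J, I + J = K → 0 ≤ f I J) : 0 ≤ splitSum K f := by
  simpa using splitSum_mono h

end Ordered

end MultisetSums

section IndexShifts

open Finset.HasAntidiagonal (antidiagonal mem_antidiagonal)

/-- The value `f (n - 1)`, understood to be zero for `n = 0`. -/
def shiftDown {M : Type*} [Zero M] (f : ℕ → M) : ℕ → M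
  | 0 => 0
  | n + 1 => f n

/-- The sum of `f μ ν` over `μ + ν = i - 2`, zero for `i < 2`: the range of the summation indices
in the quadratic part of a Virasoro constraint. -/
def pairSum {M : Type*} [AddCommMonoid M] (f : ℕ → ℕ → M) : ℕ → M
  | 0 => 0
  | 1 => 0
  | i + 2 => ∑ p ∈ antidiagonal i, f p.1 p.2

section Additive

variable {M : Type*} [AddCommMonoid M]

@[simp] theorem shiftDown_zero (f : ℕ → M) : shiftDown f 0 = 0 := rfl

@[simp] theorem shiftDown_succ (f : ℕ → M) (n : ℕ) : shiftDown f (n + 1) = f n := rfl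

theorem shiftDown_add (f f' : ℕ → M) (n : ℕ) :
    shiftDown (fun m => f m + f' m) n = shiftDown f n + shiftDown f' n := by
  cases n <;> simp

theorem shiftDown_comm (f : ℕ → ℕ → M) (a b : ℕ) :
    shiftDown (fun m => shiftDown (fun n => f m n) b) a =
      shiftDown (fun n => shiftDown (fun m => f m n) a) b := by
  cases a <;> cases b <;> simp

@[simp] theorem pairSum_zero (f : ℕ → ℕ → M) : pairSum f 0 = 0 := rfl

@[simp] theorem pairSum_one (f : ℕ → ℕ → M) : pairSum f 1 = 0 := rfl

theorem pairSum_add_two (f : ℕ → ℕ → M) (i : ℕ) :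
    pairSum f (i + 2) = ∑ p ∈ antidiagonal i, f p.1 p.2 := rfl

@[simp] theorem pairSum_const_zero (i : ℕ) : pairSum (fun _ _ => (0 : M)) i = 0 := by
  match i with
  | 0 => rfl
  | 1 => rfl
  | i + 2 => exact Finset.sum_const_zero

theorem pairSum_congr {f f' : ℕ → ℕ → M} (i : ℕ)
    (h : ∀ μ ν, μ + ν + 2 = i → f μ ν = f' μ ν) : pairSum f i = pairSum f' i := by
  match i with
  | 0 => rfl
  | 1 => rfl
  | i + 2 =>
    refine Finset.sum_congr rfl fun p hp => h _ _ ?_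
    rw [mem_antidiagonal.mp hp]

theorem pairSum_add (f f' : ℕ → ℕ → M) (i : ℕ) :
    pairSum (fun μ ν => f μ ν + f' μ ν) i = pairSum f i + pairSum f' i := by
  match i with
  | 0 => simp
  | 1 => simp
  | i + 2 => exact Finset.sum_add_distrib

theorem pairSum_swap (f : ℕ → ℕ → M) (i : ℕ) :
    pairSum (fun μ ν => f ν μ) i = pairSum f i := by
  match i with
  | 0 => simp
  | 1 => simp
  | i + 2 => exact Finset.Nat.sum_antidiagonal_swap (f := fun p => f p.1 p.2)

theorem pairSum_ite_eq_zero_left (h : ℕ → M) (i : ℕ) :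
    pairSum (fun μ ν => if μ = 0 then h ν else 0) i = shiftDown (shiftDown h) i := by
  match i with
  | 0 => rfl
  | 1 => rfl
  | i + 2 =>
    rw [pairSum_add_two, Finset.sum_eq_single (0, i)]
    · simp
    · rintro ⟨μ, ν⟩ hp hne
      rw [mem_antidiagonal] at hp
      exact if_neg fun hμ : μ = 0 => hne (by ext <;> simp_all)
    · simp

theorem pairSum_ite_eq_zero_right (h : ℕ → M) (i : ℕ) :
    pairSum (fun μ ν => if ν = 0 then h μ else 0) i = shiftDown (shiftDown h) i := by
  rw [← pairSum_ite_eq_zero_left, ← pairSum_swap]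

theorem pairSum_nonneg [PartialOrder M] [IsOrderedAddMonoid M] {f : ℕ → ℕ → M} (i : ℕ)
    (h : ∀ μ ν, μ + ν + 2 = i → 0 ≤ f μ ν) : 0 ≤ pairSum f i := by
  match i with
  | 0 => simp
  | 1 => simp
  | i + 2 =>
    refine Finset.sum_nonneg fun p hp => h _ _ ?_
    rw [mem_antidiagonal.mp hp]

end Additive

section Multiplicative

variable {R : Type*} [CommRing R]

theorem shiftDown_mul_left (c : R) (f : ℕ → R) (n : ℕ) :
    shiftDown (fun m => c * f m) n = c * shiftDown f n := by
  cases n <;> simp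

theorem pairSum_mul_left (c : R) (f : ℕ → ℕ → R) (i : ℕ) :
    pairSum (fun μ ν => c * f μ ν) i = c * pairSum f i := by
  match i with
  | 0 => simp
  | 1 => simp
  | i + 2 => exact (Finset.mul_sum _ _ _).symm

theorem pairSum_shiftDown_left (f : ℕ → ℕ → R) (i : ℕ) :
    pairSum (fun μ ν => (2 * (μ : R) + 1) * shiftDown (fun m => f m ν) μ) (i + 1) =
      pairSum (fun μ ν => (2 * (μ : R) + 3) * f μ ν) i := by
  match i with
  | 0 => simp
  | 1 => simp [pairSum]
  | i + 2 =>
    rw [show i + 2 + 1 = (i + 1) + 2 by ring, pairSum_add_two, pairSum_add_two,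
      Finset.Nat.sum_antidiagonal_succ]
    simp only [shiftDown_zero, mul_zero, zero_add, shiftDown_succ]
    refine Finset.sum_congr rfl fun p _ => ?_
    push_cast
    ring

/-- The weights of the two summation indices add up to a constant on the range of `pairSum`. -/
theorem pairSum_shiftDown_add {a : ℕ} (ha : a ≤ 1) (f : ℕ → ℕ → R) (i : ℕ) :
    pairSum (fun μ ν => (2 * (μ : R) + 1) * shiftDown (fun m => f m ν) (a + μ) +
      (2 * (ν : R) + 1) * shiftDown (fun m => f μ m) (a + ν)) i =
      2 * ((i : R) - a) * shiftDown (pairSum f) (a + i) := by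
  interval_cases a
  · rcases i with _ | i
    · simp
    simp only [zero_add, Nat.cast_zero, sub_zero, shiftDown_succ]
    rw [pairSum_add, pairSum_shiftDown_left,
      ← pairSum_swap fun μ ν => (2 * (ν : R) + 1) * shiftDown (fun m => f μ m) ν,
      pairSum_shiftDown_left fun μ ν => f ν μ,
      ← pairSum_swap fun μ ν => (2 * (μ : R) + 3) * f ν μ, ← pairSum_add, ← pairSum_mul_left]
    refine pairSum_congr _ fun μ ν h => ?_
    rw [← h]
    push_cast
    ring
  · simp only [add_comm 1, shiftDown_succ, ← pairSum_mul_left]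
    refine pairSum_congr _ fun μ ν h => ?_
    rw [← h]
    push_cast
    ring

end Multiplicative

/-- The sum over the entries `k` of `K` of `2 k + 1` times the value of `f` at the index
`i + k - 1` and the remaining entries: an index `i` is merged with an entry of `K`. -/
def mergeSum {R : Type*} [Semiring R] (i : ℕ) (K : Multiset ℕ) (f : ℕ → Multiset ℕ → R) : R :=
  eraseSum K fun k L => (2 * (k : R) + 1) * shiftDown (fun m => f m L) (i + k)

section MergeSum

variable {R : Type*} [CommRing R]

@[simp] theorem mergeSum_empty (i : ℕ) (f : ℕ → Multiset ℕ → R) : mergeSum i 0 f = 0 := by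
  simp [mergeSum]

theorem mergeSum_cons (i a : ℕ) (K : Multiset ℕ) (f : ℕ → Multiset ℕ → R) :
    mergeSum i (a ::ₘ K) f = (2 * (a : R) + 1) * shiftDown (fun m => f m K) (i + a) +
      mergeSum i K fun m L => f m (a ::ₘ L) :=
  eraseSum_cons _ _ _

theorem mergeSum_congr {i : ℕ} {K : Multiset ℕ} {f f' : ℕ → Multiset ℕ → R}
    (h : ∀ m k L, m + 1 = i + k → k ::ₘ L = K → f m L = f' m L) :
    mergeSum i K f = mergeSum i K f' := by
  refine eraseSum_congr fun k L hL => ?_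
  rcases hik : i + k with _ | m
  · simp
  · simp only [shiftDown_succ]
    rw [h m k L hik.symm hL]

theorem mergeSum_eq_zero {i : ℕ} {K : Multiset ℕ} {f : ℕ → Multiset ℕ → R}
    (h : ∀ m k L, m + 1 = i + k → k ::ₘ L = K → f m L = 0) : mergeSum i K f = 0 := by
  rw [mergeSum_congr (f' := fun _ _ => 0) h]
  refine eraseSum_eq_zero fun k L _ => ?_
  cases i + k <;> simp

theorem mergeSum_add (i : ℕ) (K : Multiset ℕ) (f f' : ℕ → Multiset ℕ → R) :
    mergeSum i K (fun m L => f m L + f' m L) = mergeSum i K f + mergeSum i K f' := by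
  simp only [mergeSum, shiftDown_add, mul_add, eraseSum_add]

theorem mergeSum_mul_left (i : ℕ) (K : Multiset ℕ) (c : R) (f : ℕ → Multiset ℕ → R) :
    mergeSum i K (fun m L => c * f m L) = c * mergeSum i K f := by
  simp only [mergeSum, shiftDown_mul_left, ← eraseSum_mul_left]
  exact eraseSum_congr fun k L _ => mul_left_comm _ _ _

theorem mergeSum_mul_right (i : ℕ) (K : Multiset ℕ) (c : R) (f : ℕ → Multiset ℕ → R) :
    mergeSum i K (fun m L => f m L * c) = mergeSum i K f * c := by
  simp only [mul_comm _ c, mergeSum_mul_left]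

theorem mergeSum_sum {ι : Type*} (i : ℕ) (K : Multiset ℕ) (s : Finset ι)
    (f : ι → ℕ → Multiset ℕ → R) :
    mergeSum i K (fun m L => ∑ q ∈ s, f q m L) = ∑ q ∈ s, mergeSum i K (f q) := by
  simp only [mergeSum, ← eraseSum_sum]
  refine eraseSum_congr fun k L _ => ?_
  cases i + k <;> simp [Finset.mul_sum]

theorem mergeSum_pairSum (a : ℕ) (K : Multiset ℕ) (f : ℕ → Multiset ℕ → ℕ → ℕ → R) (i : ℕ) :
    mergeSum a K (fun m L => pairSum (f m L) i) =
      pairSum (fun μ ν => mergeSum a K fun m L => f m L μ ν) i := by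
  match i with
  | 0 => exact mergeSum_eq_zero fun _ _ _ _ _ => pairSum_zero _
  | 1 => exact mergeSum_eq_zero fun _ _ _ _ _ => pairSum_one _
  | i + 2 => simp only [pairSum_add_two, mergeSum_sum]

theorem mergeSum_comm (a b : ℕ) (K : Multiset ℕ) (f : ℕ → ℕ → Multiset ℕ → R) :
    mergeSum a K (fun m L => mergeSum b L fun n N => f m n N) =
      mergeSum b K (fun n L => mergeSum a L fun m N => f m n N) := by
  have expand (a b : ℕ) (f : ℕ → ℕ → Multiset ℕ → R) :
      mergeSum a K (fun m L => mergeSum b L fun n N => f m n N) =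
        eraseSum K fun k L => eraseSum L fun l N => (2 * (k : R) + 1) * ((2 * (l : R) + 1) *
          shiftDown (fun m => shiftDown (fun n => f m n N) (b + l)) (a + k)) := by
    refine eraseSum_congr fun k L _ => ?_
    rw [eraseSum_mul_left]
    cases a + k <;> simp [mergeSum]
  rw [expand, expand b a fun n m => f m n, eraseSum_comm]
  refine eraseSum_congr fun k L _ => eraseSum_congr fun l N _ => ?_
  rw [shiftDown_comm, mul_left_comm]

/-- Merging with `a` and with `i` in either order: the difference of the two weights is
`2 (i - a)`, as in the commutator of two vector fields on the line. -/
theorem mergeSum_mergeSum {a : ℕ} (ha : a ≤ 1) (i : ℕ) (K : Multiset ℕ)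
    (f : ℕ → Multiset ℕ → R) :
    mergeSum i K (fun m L => (2 * (m : R) + 1) * shiftDown (fun n => f n L) (a + m)) +
        (if a = 0 then eraseSum K fun k L =>
          if k = 0 then shiftDown (shiftDown fun m => f m L) i else 0 else 0) =
      mergeSum a K (fun m L => (2 * (m : R) + 1) * shiftDown (fun n => f n L) (i + m)) +
        2 * ((i : R) - a) * shiftDown (fun m => mergeSum m K f) (a + i) := by
  have hshift : shiftDown (fun m => mergeSum m K f) (a + i) = eraseSum K fun k L =>
      (2 * (k : R) + 1) * shiftDown (fun m => shiftDown (fun n => f n L) (m + k)) (a + i) := by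
    cases a + i <;> simp [mergeSum]
  rw [hshift, ← eraseSum_mul_left]
  interval_cases a
  · rw [if_pos rfl, mergeSum, mergeSum, ← eraseSum_add, ← eraseSum_add]
    refine eraseSum_congr fun k L _ => ?_
    rcases k with _ | k <;> rcases i with _ | i
    · simp
    · simp
      ring
    · simp
    · simp only [show i + 1 + (k + 1) = (i + k + 1) + 1 by ring, shiftDown_succ,
        show 0 + (k + 1) = k + 1 by ring, show 0 + (i + 1) = i + 1 by ring,
        show 0 + (i + k + 1) = (i + k) + 1 by ring, show i + (k + 1) = (i + k) + 1 by ring,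
        show i + 1 + k = (i + k) + 1 by ring, Nat.add_eq_zero_iff, one_ne_zero, and_false,
        if_false]
      push_cast
      ring
  · rw [if_neg one_ne_zero, add_zero, mergeSum, mergeSum, ← eraseSum_add]
    refine eraseSum_congr fun k L _ => ?_
    simp only [add_comm 1, shiftDown_succ]
    rcases hik : i + k with _ | m
    · simp
    · have hm : (i : R) + k = m + 1 := mod_cast congrArg (Nat.cast (R := R)) hik
      simp only [shiftDown_succ]
      linear_combination -(2 * (2 * (k : R) + 1) * f m L) * hm

end MergeSum

end IndexShifts

section Virasoro

open Finset.HasAntidiagonal (antidiagonal mem_antidiagonal)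

variable {R : Type*}

section QuadraticPart

variable [CommRing R]

/-- The product terms of the recursion: the genus and the external indices are distributed over
two amplitudes with first indices `μ` and `ν`. -/
def productTerm (G H : ℕ → ℕ → Multiset ℕ → R) (g μ ν : ℕ) (K : Multiset ℕ) : R :=
  ∑ q ∈ antidiagonal g, splitSum K fun I J => G q.1 μ I * H q.2 ν J

/-- The term of the recursion in which both `μ` and `ν` belong to one amplitude of genus
`g - 1`. -/
def loopTerm (G : ℕ → ℕ → Multiset ℕ → R) (g μ ν : ℕ) (K : Multiset ℕ) : R :=
  if g = 0 then 0 else G (g - 1) μ (ν ::ₘ K)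

/-- The quadratic part of the recursion: the loop term and the product terms. -/
def quadTerm (G : ℕ → ℕ → Multiset ℕ → R) (g μ ν : ℕ) (K : Multiset ℕ) : R :=
  loopTerm G g μ ν K + productTerm G G g μ ν K

/-- The sum of the quadratic part over the pairs of indices into which `i` is cut. -/
def cutTerm (G : ℕ → ℕ → Multiset ℕ → R) (g i : ℕ) (K : Multiset ℕ) : R :=
  pairSum (fun μ ν => quadTerm G g μ ν K) i

variable (G G' H : ℕ → ℕ → Multiset ℕ → R) (g μ ν : ℕ) (K : Multiset ℕ)

theorem productTerm_swap : productTerm G H g μ ν K = productTerm H G g ν μ K := by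
  rw [productTerm, ← Finset.Nat.sum_antidiagonal_swap]
  refine Finset.sum_congr rfl fun q _ => ?_
  rw [← splitSum_swap]
  exact splitSum_congr fun I J _ => mul_comm _ _

theorem productTerm_add_left :
    productTerm (fun g i K => G g i K + G' g i K) H g μ ν K =
      productTerm G H g μ ν K + productTerm G' H g μ ν K := by
  simp only [productTerm, add_mul, splitSum_add, Finset.sum_add_distrib]

theorem productTerm_mul_left (c : R) :
    productTerm (fun g i K => c * G g i K) H g μ ν K = c * productTerm G H g μ ν K := by
  simp only [productTerm, mul_assoc, splitSum_mul_left, Finset.mul_sum]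

theorem productTerm_cons (a : ℕ) :
    productTerm G H g μ ν (a ::ₘ K) =
      productTerm (fun g i K => G g i (a ::ₘ K)) H g μ ν K +
        productTerm G (fun g i K => H g i (a ::ₘ K)) g μ ν K := by
  simp only [productTerm, splitSum_cons, Finset.sum_add_distrib]

theorem productTerm_shiftDown_left (a : ℕ) :
    productTerm (fun g i K => (2 * (i : R) + 1) * shiftDown (fun m => G g m K) (a + i)) H g μ ν K =
      (2 * (μ : R) + 1) * shiftDown (fun m => productTerm G H g m ν K) (a + μ) := by
  simp only [productTerm, mul_assoc, splitSum_mul_left, ← Finset.mul_sum]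
  cases a + μ <;> simp

theorem productTerm_mergeSum_left (a : ℕ) :
    productTerm (fun g i K => mergeSum a K fun m L => G g i (m ::ₘ L)) H g μ ν K =
      mergeSum a K fun m L => productTerm (fun g i I => G g i (m ::ₘ I)) H g μ ν L := by
  simp only [productTerm, mergeSum_sum, ← mergeSum_mul_right]
  refine Finset.sum_congr rfl fun q _ => ?_
  simp only [mergeSum]
  rw [splitSum_eraseSum_left K fun k I J => (2 * (k : R) + 1) *
    shiftDown (fun m => G q.1 μ (m ::ₘ I) * H q.2 ν J) (a + k)]
  refine eraseSum_congr fun k L _ => ?_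
  rw [splitSum_mul_left]
  cases a + k <;> simp

variable {G g K} in
/-- If inserting `a` acts on smaller amplitudes as `T`, it acts on products by the Leibniz rule;
the factors that are not smaller come with a vanishing disk amplitude. -/
theorem productTerm_cons_eq_of_insert {a : ℕ} {c : R} {T : ℕ → ℕ → Multiset ℕ → R}
    (hdisk : ∀ i, G 0 i 0 = 0)
    (hT : ∀ g' i' K', 2 * g' + K'.card < 2 * g + K.card → c * G g' i' (a ::ₘ K') = T g' i' K') :
    c * productTerm G G g μ ν (a ::ₘ K) = productTerm T G g μ ν K + productTerm G T g μ ν K := by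
  have left (μ ν : ℕ) : c * productTerm (fun g i K => G g i (a ::ₘ K)) G g μ ν K =
      productTerm T G g μ ν K := by
    simp only [productTerm, Finset.mul_sum, ← splitSum_mul_left, ← mul_assoc]
    refine Finset.sum_congr rfl fun q hq => splitSum_congr fun I J hIJ => ?_
    have hg := mem_antidiagonal.mp hq
    have hcard : I.card + J.card = K.card := by rw [← hIJ, Multiset.card_add]
    by_cases hsmall : 2 * q.1 + I.card < 2 * g + K.card
    · rw [hT _ _ _ hsmall]
    · have hJ : J = 0 := Multiset.card_eq_zero.mp (by omega)
      rw [hJ, show q.2 = 0 by omega, hdisk, mul_zero, mul_zero]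
  rw [productTerm_cons, mul_add, left, productTerm_swap G, left, productTerm_swap G]

end QuadraticPart

variable [Field R]

/-- The inhomogeneous part of the constraints: the contributions of `(g, n) = (0, 3)` and
`(1, 1)`. -/
def seedTerm (g i : ℕ) (K : Multiset ℕ) : R :=
  (if g = 0 ∧ i = 0 ∧ K = {0, 0} then 1 else 0) + (if g = 1 ∧ i = 1 ∧ K = 0 then 1 / 8 else 0)

theorem seedTerm_zero (g : ℕ) (K : Multiset ℕ) :
    (seedTerm g 0 K : R) = if g = 0 ∧ K = {0, 0} then 1 else 0 := by
  simp [seedTerm]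

theorem seedTerm_one (g : ℕ) (K : Multiset ℕ) :
    (seedTerm g 1 K : R) = if g = 1 ∧ K = 0 then 1 / 8 else 0 := by
  simp [seedTerm]

theorem seedTerm_add_two (g i : ℕ) (K : Multiset ℕ) : (seedTerm g (i + 2) K : R) = 0 := by
  simp [seedTerm]

theorem seedTerm_cons (g i a : ℕ) (K : Multiset ℕ) :
    (seedTerm g i (a ::ₘ K) : R) = if g = 0 ∧ i = 0 ∧ a = 0 ∧ K = {0} then 1 else 0 := by
  have htorus : ¬(g = 1 ∧ i = 1 ∧ a ::ₘ K = 0) := fun h => Multiset.cons_ne_zero h.2.2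
  simp only [seedTerm, if_neg htorus, add_zero, cons_eq_pair_self_iff]

theorem seedTerm_cons_comm (g i a : ℕ) (K : Multiset ℕ) :
    (seedTerm g i (a ::ₘ K) : R) = seedTerm g a (i ::ₘ K) := by
  simp only [seedTerm_cons, and_left_comm]

theorem productTerm_seedTerm_left (H : ℕ → ℕ → Multiset ℕ → R) (g μ ν : ℕ) (K : Multiset ℕ)
    (a : ℕ) :
    productTerm (fun g i K => seedTerm g i (a ::ₘ K)) H g μ ν K =
      if a = 0 ∧ μ = 0 then eraseSum K fun k L => if k = 0 then H g ν L else 0 else 0 := by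
  rw [productTerm, Finset.sum_eq_single (0, g)]
  · by_cases h : a = 0 ∧ μ = 0
    · simp [seedTerm_cons, h.1, h.2, splitSum_ite_eq_singleton]
    · have hseed (I : Multiset ℕ) : (seedTerm 0 μ (a ::ₘ I) : R) = 0 := by
        rw [seedTerm_cons, if_neg (by tauto)]
      simp only [hseed, if_neg h, zero_mul, splitSum_const_zero]
  · intro q hq hne
    have hq0 : q.1 ≠ 0 := fun h => hne (by
      have := mem_antidiagonal.mp hq
      ext <;> simp_all)
    simp [seedTerm_cons, hq0]
  · simp

/-- The constraint with index `a` applied to an amplitude with first index `i` and further indices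
`K`, without its quadratic part: `a` is raised by one or merged with one of the other indices. -/
def insertTerm (a : ℕ) (G : ℕ → ℕ → Multiset ℕ → R) (g i : ℕ) (K : Multiset ℕ) : R :=
  2 * G g i ((a + 1) ::ₘ K) + (2 * (i : R) + 1) * shiftDown (fun m => G g m K) (a + i) +
    mergeSum a K (fun m L => G g i (m ::ₘ L)) + seedTerm g i (a ::ₘ K)

section InsertTerm

variable (a : ℕ) (G H : ℕ → ℕ → Multiset ℕ → R) (g μ ν : ℕ) (K : Multiset ℕ)

theorem productTerm_insertTerm_left :
    productTerm (insertTerm a G) H g μ ν K =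
      2 * productTerm (fun g i K => G g i ((a + 1) ::ₘ K)) H g μ ν K +
      (2 * (μ : R) + 1) * shiftDown (fun m => productTerm G H g m ν K) (a + μ) +
      mergeSum a K (fun m L => productTerm (fun g i I => G g i (m ::ₘ I)) H g μ ν L) +
      if a = 0 ∧ μ = 0 then eraseSum K fun k L => if k = 0 then H g ν L else 0 else 0 := by
  rw [← productTerm_shiftDown_left, ← productTerm_mergeSum_left, ← productTerm_seedTerm_left,
    ← productTerm_mul_left, ← productTerm_add_left, ← productTerm_add_left,
    ← productTerm_add_left]
  rfl

theorem productTerm_insertTerm_add :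
    productTerm (insertTerm a G) G g μ ν K + productTerm G (insertTerm a G) g μ ν K =
      2 * productTerm G G g μ ν ((a + 1) ::ₘ K) +
      ((2 * (μ : R) + 1) * shiftDown (fun m => productTerm G G g m ν K) (a + μ) +
        (2 * (ν : R) + 1) * shiftDown (fun m => productTerm G G g μ m K) (a + ν)) +
      mergeSum a K (fun m L => productTerm G G g μ ν (m ::ₘ L)) +
      ((if a = 0 ∧ μ = 0 then eraseSum K fun k L => if k = 0 then G g ν L else 0 else 0) +
        if a = 0 ∧ ν = 0 then eraseSum K fun k L => if k = 0 then G g μ L else 0 else 0) := by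
  simp only [productTerm_cons, mergeSum_add]
  rw [productTerm_swap G (insertTerm a G), productTerm_insertTerm_left,
    productTerm_insertTerm_left]
  simp only [productTerm_swap _ G g _ μ]
  ring

theorem loopTerm_insertTerm :
    loopTerm (insertTerm a G) g μ ν K =
      2 * loopTerm G g μ ν ((a + 1) ::ₘ K) +
      ((2 * (μ : R) + 1) * shiftDown (fun m => loopTerm G g m ν K) (a + μ) +
        (2 * (ν : R) + 1) * shiftDown (fun m => loopTerm G g μ m K) (a + ν)) +
      mergeSum a K (fun m L => loopTerm G g μ ν (m ::ₘ L)) +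
      if a = 0 ∧ μ = 0 then if g = 1 ∧ ν = 0 ∧ K = 0 then 1 else 0 else 0 := by
  rcases g with _ | g
  · have hshift (n : ℕ) : shiftDown (fun _ => (0 : R)) n = 0 := by cases n <;> rfl
    simp [loopTerm, hshift, mergeSum_eq_zero]
  · simp only [loopTerm, Nat.add_eq_zero_iff, one_ne_zero, and_false, if_false,
      Nat.add_sub_cancel, insertTerm, mergeSum_cons, Multiset.cons_swap _ ν, seedTerm_cons,
      eq_comm (b := ({0} : Multiset ℕ)), Multiset.singleton_eq_cons_iff, Nat.add_eq_right]
    split_ifs <;> first | ring1 | grind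

theorem quadTerm_insertTerm :
    loopTerm (insertTerm a G) g μ ν K +
        (productTerm (insertTerm a G) G g μ ν K + productTerm G (insertTerm a G) g μ ν K) =
      2 * quadTerm G g μ ν ((a + 1) ::ₘ K) +
      ((2 * (μ : R) + 1) * shiftDown (fun m => quadTerm G g m ν K) (a + μ) +
        (2 * (ν : R) + 1) * shiftDown (fun m => quadTerm G g μ m K) (a + ν)) +
      mergeSum a K (fun m L => quadTerm G g μ ν (m ::ₘ L)) +
      ((if a = 0 ∧ μ = 0 then eraseSum K fun k L => if k = 0 then G g ν L else 0 else 0) +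
        (if a = 0 ∧ ν = 0 then eraseSum K fun k L => if k = 0 then G g μ L else 0 else 0) +
        if a = 0 ∧ μ = 0 then if g = 1 ∧ ν = 0 ∧ K = 0 then 1 else 0 else 0) := by
  rw [loopTerm_insertTerm, productTerm_insertTerm_add]
  simp only [quadTerm, shiftDown_add, mergeSum_add]
  ring

theorem mergeSum_insertTerm (i : ℕ) :
    mergeSum i K (insertTerm a G g) =
      2 * mergeSum i K (fun m L => G g m ((a + 1) ::ₘ L)) +
      mergeSum i K (fun m L => (2 * (m : R) + 1) * shiftDown (fun n => G g n L) (a + m)) +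
      mergeSum a K (fun n L => mergeSum i L fun m N => G g m (n ::ₘ N)) +
      mergeSum i K (fun m L => seedTerm g m (a ::ₘ L)) := by
  rw [mergeSum_comm, ← mergeSum_mul_left, ← mergeSum_add, ← mergeSum_add, ← mergeSum_add]
  rfl

end InsertTerm

theorem mergeSum_one_seedTerm (g : ℕ) (K : Multiset ℕ) :
    mergeSum 1 K (fun m L => (seedTerm g 0 (m ::ₘ L) : R)) =
      if g = 0 ∧ K = {0, 0} then 2 else 0 := by
  by_cases hK : K = {0, 0}
  · rw [hK, Multiset.insert_eq_cons, ← Multiset.cons_zero 0, mergeSum_cons, mergeSum_cons]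
    simp only [mergeSum_empty, seedTerm_cons, shiftDown_succ, add_zero, Multiset.cons_zero,
      and_true, true_and]
    split_ifs <;> norm_num
  · rw [if_neg fun h => hK h.2]
    refine mergeSum_eq_zero fun m k L hm hL => ?_
    rw [seedTerm_cons, if_neg]
    rintro ⟨-, -, rfl, rfl⟩
    obtain rfl : k = 0 := by omega
    exact hK hL.symm

/-- The commutator of the inhomogeneous terms; for `a = 0` the loop term contributes the central
term on the left. -/
theorem mergeSum_seedTerm [CharZero R] {a : ℕ} (ha : a ≤ 1) (g i : ℕ) (K : Multiset ℕ) :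
    mergeSum i K (fun m L => (seedTerm g m (a ::ₘ L) : R)) +
        1 / 2 * (if a = 0 then if g = 1 ∧ i = 2 ∧ K = 0 then 1 else 0 else 0) =
      mergeSum a K (fun m L => seedTerm g i (m ::ₘ L)) +
        2 * ((i : R) - a) * shiftDown (fun m => seedTerm g m K) (a + i) := by
  have hzero {b j : ℕ} (hj : j ≠ 0) :
      mergeSum b K (fun m L => (seedTerm g j (m ::ₘ L) : R)) = 0 :=
    mergeSum_eq_zero fun m k L _ _ => by rw [seedTerm_cons, if_neg fun h => hj h.2.1]
  simp only [seedTerm_cons_comm g _ a]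
  interval_cases a
  · match i with
    | 0 => simp
    | 1 =>
      rw [mergeSum_one_seedTerm, hzero one_ne_zero, shiftDown_succ, seedTerm_zero]
      simp
    | i + 2 =>
      have hleft : mergeSum (i + 2) K (fun m L => (seedTerm g 0 (m ::ₘ L) : R)) = 0 :=
        mergeSum_eq_zero fun m k L hm _ => by rw [seedTerm_cons, if_neg fun h => by omega]
      rw [hleft, hzero (by omega), zero_add (i + 2), shiftDown_succ]
      rcases i with _ | i
      · rw [seedTerm_one]
        simp only [if_true, true_and, ite_and]
        split_ifs <;> norm_num
      · simp [seedTerm_add_two]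
  · rw [hzero one_ne_zero, if_neg one_ne_zero, add_comm 1 i, shiftDown_succ]
    match i with
    | 0 =>
      rw [mergeSum_one_seedTerm, seedTerm_zero]
      split_ifs <;> norm_num
    | 1 => simp [hzero]
    | i + 2 =>
      rw [hzero (by omega), seedTerm_add_two]
      simp

/-- `G` solves the Virasoro constraints with parameter `u`. Here `G g i K` stands for the amplitude
of genus `g` with first index `i` and further indices `K`, multiplied by `(2k+1)!!` for each index
`k`; it vanishes when the sum of the indices exceeds the dimension `3 g - 3 + n`. -/
structure IsVirasoroSolution (u : R) (G : ℕ → ℕ → Multiset ℕ → R) : Prop where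
  eq_zero_of_lt : ∀ g i K, 3 * g + K.card < i + K.sum + 2 → G g i K = 0
  constraint : ∀ g i K, 6 * u * G g i K =
    2 * G g (i + 1) K + mergeSum i K (G g) + 1 / 2 * cutTerm G g i K + seedTerm g i K

/-- Induction on `2 g + n`, then downwards on the sum of the indices. -/
theorem amplitude_induction {P : ℕ → ℕ → Multiset ℕ → Prop}
    (base : ∀ g i K, 3 * g + K.card ≤ i + K.sum → P g i K)
    (step : ∀ g i K, (∀ g' i' K', 2 * g' + K'.card < 2 * g + K.card → P g' i' K') →
      (∀ i' K', K'.card = K.card → i + K.sum < i' + K'.sum → P g i' K') → P g i K)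
    (g i : ℕ) (K : Multiset ℕ) : P g i K := by
  suffices h : ∀ N c g i K, 2 * g + Multiset.card K = N → 3 * g + K.card ≤ i + K.sum + c →
      P g i K from h _ (3 * g + K.card) g i K rfl (by omega)
  intro N
  induction N using Nat.strong_induction_on with
  | _ N ihN =>
    intro c
    induction c with
    | zero => exact fun g i K _ h => base g i K (by omega)
    | succ c ihc =>
      intro g i K hN hc
      refine step g i K (fun g' i' K' h => ihN _ (by omega) (3 * g' + K'.card) g' i' K' rfl
        (by omega)) fun i' K' hK h => ihc g i' K' (by omega) (by omega)

namespace IsVirasoroSolution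

variable {u : R} {G : ℕ → ℕ → Multiset ℕ → R} (hG : IsVirasoroSolution u G)

include hG

theorem disk_eq_zero (i : ℕ) : G 0 i 0 = 0 :=
  hG.eq_zero_of_lt 0 i 0 (by simp)

variable {a : ℕ} {g : ℕ} {K : Multiset ℕ}

theorem insertTerm_eq_zero_of_le (a : ℕ) {i : ℕ} (h : 3 * g + K.card ≤ i + K.sum) :
    insertTerm a G g i K = 0 := by
  have hraised : G g i ((a + 1) ::ₘ K) = 0 := hG.eq_zero_of_lt _ _ _ (by simp; omega)
  have hshift : shiftDown (fun m => G g m K) (a + i) = 0 := by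
    rcases hj : a + i with _ | j
    · rfl
    · exact hG.eq_zero_of_lt _ _ _ (by omega)
  have hmerge : mergeSum a K (fun m L => G g i (m ::ₘ L)) = 0 :=
    mergeSum_eq_zero fun m k L hm hL => hG.eq_zero_of_lt _ _ _ (by
      simp only [← hL, Multiset.card_cons, Multiset.sum_cons] at h ⊢
      omega)
  have hseed : (seedTerm g i (a ::ₘ K) : R) = 0 := by
    rw [seedTerm_cons, if_neg]
    rintro ⟨rfl, rfl, -, rfl⟩
    simp at h
  rw [insertTerm, hraised, hshift, hmerge, hseed]
  ring

theorem quadTerm_cons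
    (hT : ∀ g' i' K', 2 * g' + K'.card < 2 * g + K.card →
      6 * u * G g' i' (a ::ₘ K') = insertTerm a G g' i' K') (μ ν : ℕ) :
    6 * u * quadTerm G g μ ν (a ::ₘ K) = loopTerm (insertTerm a G) g μ ν K +
      (productTerm (insertTerm a G) G g μ ν K + productTerm G (insertTerm a G) g μ ν K) := by
  have hloop : 6 * u * loopTerm G g μ ν (a ::ₘ K) = loopTerm (insertTerm a G) g μ ν K := by
    rw [loopTerm, loopTerm]
    split_ifs with hg
    · exact mul_zero _
    · rw [Multiset.cons_swap, hT _ _ _ (by rw [Multiset.card_cons]; omega)]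
  rw [quadTerm, mul_add, hloop, productTerm_cons_eq_of_insert μ ν hG.disk_eq_zero hT]

theorem cutTerm_cons (ha : a ≤ 1)
    (hT : ∀ g' i' K', 2 * g' + K'.card < 2 * g + K.card →
      6 * u * G g' i' (a ::ₘ K') = insertTerm a G g' i' K') (i : ℕ) :
    6 * u * cutTerm G g i (a ::ₘ K) = 2 * cutTerm G g i ((a + 1) ::ₘ K) +
      2 * ((i : R) - a) * shiftDown (fun m => cutTerm G g m K) (a + i) +
      mergeSum a K (fun m L => cutTerm G g i (m ::ₘ L)) +
      (2 * (if a = 0 then eraseSum K fun k L =>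
          if k = 0 then shiftDown (shiftDown fun m => G g m L) i else 0 else 0) +
        if a = 0 then if g = 1 ∧ i = 2 ∧ K = 0 then 1 else 0 else 0) := by
  have hweight := pairSum_shiftDown_add ha (fun μ ν => quadTerm G g μ ν K) i
  have hzero : (if a = 0 then eraseSum K fun k L =>
        if k = 0 then shiftDown (shiftDown fun m => G g m L) i else 0 else 0) =
      shiftDown (shiftDown fun m => if a = 0 then
        eraseSum K fun k L => if k = 0 then G g m L else 0 else 0) i := by
    rcases i with _ | _ | i <;> simp
  have hone : (if a = 0 then if g = 1 ∧ i = 2 ∧ K = 0 then 1 else 0 else (0 : R)) =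
      shiftDown (shiftDown fun m => if a = 0 then if g = 1 ∧ m = 0 ∧ K = 0 then 1 else 0
        else 0) i := by
    rcases i with _ | _ | i <;> simp
  rw [hzero, hone, two_mul (shiftDown _ _)]
  nth_rw 2 [← pairSum_ite_eq_zero_right]
  rw [← pairSum_ite_eq_zero_left, ← pairSum_ite_eq_zero_left]
  simp only [cutTerm, mergeSum_pairSum, ← pairSum_mul_left, ← pairSum_add] at hweight ⊢
  rw [← hweight, ← pairSum_add, ← pairSum_add, ← pairSum_add]
  refine pairSum_congr i fun μ ν _ => ?_
  rw [hG.quadTerm_cons hT, quadTerm_insertTerm]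
  simp only [ite_and, and_comm (a := a = 0)]

theorem mergeSum_constraint (a g i : ℕ) (K : Multiset ℕ) :
    6 * u * mergeSum a K (fun m L => G g i (m ::ₘ L)) =
      2 * mergeSum a K (fun m L => G g (i + 1) (m ::ₘ L)) +
      (mergeSum a K (fun m L => (2 * (m : R) + 1) * shiftDown (fun n => G g n L) (i + m)) +
        mergeSum a K (fun m L => mergeSum i L fun n N => G g n (m ::ₘ N))) +
      1 / 2 * mergeSum a K (fun m L => cutTerm G g i (m ::ₘ L)) +
      mergeSum a K (fun m L => seedTerm g i (m ::ₘ L)) := by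
  simp only [← mergeSum_mul_left, ← mergeSum_add, ← mergeSum_cons, ← hG.constraint]

theorem shiftDown_constraint (g j : ℕ) (K : Multiset ℕ) (c : R) (hc : j = 0 → c = 0) :
    c * (6 * u * shiftDown (fun m => G g m K) j) = c * (2 * G g j K +
      shiftDown (fun m => mergeSum m K (G g)) j + 1 / 2 * shiftDown (fun m => cutTerm G g m K) j +
      shiftDown (fun m => seedTerm g m K) j) := by
  rcases j with _ | j
  · rw [hc rfl, zero_mul, zero_mul]
  · simp only [shiftDown_succ, hG.constraint]

/-- The string equation `a = 0` and the dilaton equation `a = 1`. The constraint with index `i` is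
that of the Virasoro operator `L_{i-1}`; for `i ≤ 1` it has no quadratic part, and the commutators
`[L_{a-1}, L_{i-1}]` carry it over from the first index to an index of the tail. -/
theorem tail_constraint [CharZero R] (hu : u ≠ 0) (ha : a ≤ 1) (g i : ℕ) (K : Multiset ℕ) :
    6 * u * G g i (a ::ₘ K) = insertTerm a G g i K := by
  induction g, i, K using amplitude_induction with
  | base g i K h =>
    rw [hG.insertTerm_eq_zero_of_le a h, hG.eq_zero_of_lt _ _ _ (by simp; omega), mul_zero]
  | step g i K ih_small ih_large =>
    have hmerge : 6 * u * mergeSum i K (fun m L => G g m (a ::ₘ L)) =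
        mergeSum i K (insertTerm a G g) := by
      rw [← mergeSum_mul_left]
      refine mergeSum_congr fun m k L _ hL => ih_small g m L ?_
      rw [← hL, Multiset.card_cons]
      omega
    have hraise := ih_large (i + 1) K rfl (by omega)
    have hcut := hG.cutTerm_cons ha ih_small i
    have hshift := hG.shiftDown_constraint g (a + i) K (2 * ((i : R) - a)) (by
      intro h
      simp [show a = 0 by omega, show i = 0 by omega])
    have hhead := hG.constraint g i (a ::ₘ K)
    have hheadRaised := hG.constraint g i ((a + 1) ::ₘ K)
    have htail := hG.mergeSum_constraint a g i K
    have hcomm := mergeSum_mergeSum ha i K (G g)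
    have hseed := mergeSum_seedTerm (R := R) ha g i K
    rw [mergeSum_insertTerm] at hmerge
    rw [insertTerm] at hraise
    rw [mergeSum_cons, add_comm i a] at hhead
    rw [mergeSum_cons] at hheadRaised
    have hnext : (seedTerm g (i + 1) (a ::ₘ K) : R) = 0 := by simp [seedTerm_cons]
    have hnext' : (seedTerm g i ((a + 1) ::ₘ K) : R) = 0 := by simp [seedTerm_cons]
    refine mul_left_cancel₀ (mul_ne_zero (by norm_num : (6 : R) ≠ 0) hu) ?_
    rw [insertTerm]
    simp only [show i + (a + 1) = a + i + 1 by ring, show a + (i + 1) = a + i + 1 by ring,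
      shiftDown_succ, hnext, hnext'] at hraise hheadRaised
    push_cast at hraise hheadRaised
    linear_combination 6 * u * hhead + 2 * hraise + hmerge + 1 / 2 * hcut - 2 * hheadRaised -
      htail - hshift + hcomm + hseed

end IsVirasoroSolution

end Virasoro

section Majorant

open Finset.HasAntidiagonal (antidiagonal mem_antidiagonal)

variable {R : Type*} [Field R] [LinearOrder R] [IsStrictOrderedRing R]

theorem mergeSum_nonneg {i : ℕ} {K : Multiset ℕ} {f : ℕ → Multiset ℕ → R}
    (h : ∀ m k L, m + 1 = i + k → k ::ₘ L = K → 0 ≤ f m L) : 0 ≤ mergeSum i K f := by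
  refine eraseSum_nonneg fun k L hL => mul_nonneg (by positivity) ?_
  rcases hik : i + k with _ | m
  · rfl
  · exact h m k L hik.symm hL

theorem mergeSum_le {i : ℕ} {K : Multiset ℕ} {f : ℕ → Multiset ℕ → R} {W : R} (hW : 0 ≤ W)
    (h : ∀ m k L, m + 1 = i + k → k ::ₘ L = K → f m L ≤ W) :
    mergeSum i K f ≤ (2 * (K.sum : R) + K.card) * W := by
  trans eraseSum K fun k _ => (2 * (k : R) + 1) * W
  · refine eraseSum_mono fun k L hL => mul_le_mul_of_nonneg_left ?_ (by positivity)
    rcases hik : i + k with _ | m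
    · exact hW
    · exact h m k L hik.symm hL
  · rw [eraseSum, Multiset.sum_map_mul_right, Multiset.sum_map_add, Multiset.sum_map_mul_left]
    simp

theorem mul_shiftDown_le {f : ℕ → R} {W : R} (hW : 0 ≤ W) (i : ℕ)
    (h : ∀ m, m + 1 = i → f m ≤ W) : (2 * (i : R) + 1) * shiftDown f i ≤ 3 * i * W := by
  rcases i with _ | i
  · simp
  · calc (2 * ((i + 1 : ℕ) : R) + 1) * f i ≤ (2 * ((i + 1 : ℕ) : R) + 1) * W := by
          gcongr
          exact h i rfl
      _ ≤ 3 * ((i + 1 : ℕ) : R) * W := by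
          gcongr
          push_cast
          linarith [(i.cast_nonneg : (0 : R) ≤ i)]

/-- The entries zero do not contribute, and `2 k + 1 ≤ 3 k` for the others. -/
theorem mergeSum_zero_le {K : Multiset ℕ} {f : ℕ → Multiset ℕ → R} {W : R} (hW : 0 ≤ W)
    (h : ∀ m L, (m + 1) ::ₘ L = K → f m L ≤ W) : mergeSum 0 K f ≤ 3 * (K.sum : R) * W := by
  trans eraseSum K fun k _ => 3 * (k : R) * W
  · refine eraseSum_mono fun k L hL => ?_
    rw [zero_add]
    exact mul_shiftDown_le hW k fun m hm => h m L (hm ▸ hL)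
  · rw [eraseSum, Multiset.sum_map_mul_right, Multiset.sum_map_mul_left]
    simp

theorem productTerm_nonneg {G : ℕ → ℕ → Multiset ℕ → R} {g : ℕ} {K : Multiset ℕ}
    (hdisk : ∀ i, G 0 i 0 = 0)
    (h : ∀ g' i' K', 2 * g' + K'.card < 2 * g + K.card → 0 ≤ G g' i' K') (μ ν : ℕ) :
    0 ≤ productTerm G G g μ ν K := by
  refine Finset.sum_nonneg fun q hq => splitSum_nonneg fun I J hIJ => ?_
  have hgenus := mem_antidiagonal.mp hq
  have hcard : I.card + J.card = K.card := by rw [← hIJ, Multiset.card_add]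
  by_cases hI : q.1 = 0 ∧ I.card = 0
  · rw [hI.1, Multiset.card_eq_zero.mp hI.2, hdisk, zero_mul]
  by_cases hJ : q.2 = 0 ∧ J.card = 0
  · rw [hJ.1, Multiset.card_eq_zero.mp hJ.2, hdisk, mul_zero]
  exact mul_nonneg (h _ _ _ (by omega)) (h _ _ _ (by omega))

theorem seedTerm_nonneg (g i : ℕ) (K : Multiset ℕ) : (0 : R) ≤ seedTerm g i K := by
  unfold seedTerm
  positivity

theorem exists_cons_zero_of_sum_lt {K : Multiset ℕ} (h : K.sum < K.card) :
    ∃ L, K = 0 ::ₘ L := by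
  refine Multiset.exists_cons_of_mem ?_
  by_contra hzero
  have hle : K.card • 1 ≤ K.sum := Multiset.card_nsmul_le_sum fun x hx =>
    Nat.one_le_iff_ne_zero.mpr fun hx0 => hzero (hx0 ▸ hx)
  simp only [smul_eq_mul, mul_one] at hle
  omega

namespace IsVirasoroSolution

variable {u : R} {G : ℕ → ℕ → Multiset ℕ → R} (hG : IsVirasoroSolution u G)

include hG

theorem nonneg (hu : 0 < u) (g i : ℕ) (K : Multiset ℕ) : 0 ≤ G g i K := by
  induction g, i, K using amplitude_induction with
  | base g i K h => rw [hG.eq_zero_of_lt g i K (by omega)]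
  | step g i K ih_small ih_large =>
    have hraise : 0 ≤ G g (i + 1) K := ih_large _ _ rfl (by omega)
    have hmerge : 0 ≤ mergeSum i K (G g) := mergeSum_nonneg fun m k L _ hL =>
      ih_small _ _ _ (by rw [← hL, Multiset.card_cons]; omega)
    have hcut : 0 ≤ cutTerm G g i K := by
      refine pairSum_nonneg i fun μ ν _ => add_nonneg ?_
        (productTerm_nonneg hG.disk_eq_zero ih_small μ ν)
      rw [loopTerm]
      split_ifs with hg
      · rfl
      · exact ih_small _ _ _ (by rw [Multiset.card_cons]; omega)
    have hseed := seedTerm_nonneg (R := R) g i K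
    have hmul : 0 ≤ 6 * u * G g i K := by
      rw [hG.constraint]
      positivity
    exact nonneg_of_mul_nonneg_right hmul (by positivity)

theorem constraint_le {g i : ℕ} {K : Multiset ℕ} {W : R} (hW : 0 ≤ W)
    (h : ∀ i' K', K'.card + 1 = K.card → i' + K'.sum + 1 = i + K.sum → G g i' K' ≤ W) :
    6 * u * G g i K ≤ 2 * G g (i + 1) K + (2 * (K.sum : R) + K.card) * W +
      (1 / 2 * cutTerm G g i K + seedTerm g i K) := by
  have hmerge : mergeSum i K (G g) ≤ _ := mergeSum_le hW (by
    rintro m k L hm rfl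
    exact h m L (by simp) (by rw [Multiset.sum_cons]; omega))
  rw [hG.constraint]
  linarith

theorem tail_constraint_le (hu : 0 < u) {a g i : ℕ} (ha : a ≤ 1) {K : Multiset ℕ} {W : R}
    (hW : 0 ≤ W)
    (h : ∀ i' K', K'.card = K.card → i' + K'.sum + 1 = i + (a + K.sum) → G g i' K' ≤ W) :
    6 * u * G g i (a ::ₘ K) ≤ 2 * G g i ((a + 1) ::ₘ K) +
      (2 * (i : R) + 1 + (2 * (K.sum : R) + K.card)) * W + seedTerm g i (a ::ₘ K) := by
  have hmerge : mergeSum a K (fun m L => G g i (m ::ₘ L)) ≤ _ := mergeSum_le hW (by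
    rintro m k L hm rfl
    exact h i (m ::ₘ L) (by simp) (by simp only [Multiset.sum_cons]; omega))
  have hshift : (2 * (i : R) + 1) * shiftDown (fun m => G g m K) (a + i) ≤
      (2 * (i : R) + 1) * W := by
    gcongr
    rcases hj : a + i with _ | m
    · exact hW
    · exact h m K rfl (by omega)
  rw [hG.tail_constraint hu.ne' ha, insertTerm]
  linarith

/-- The string equation with the smaller weights of `mergeSum_zero_le`. -/
theorem string_equation_le (hu : 0 < u) {g i : ℕ} {K : Multiset ℕ} {W : R} (hW : 0 ≤ W)
    (h : ∀ i' K', K'.card = K.card → i' + K'.sum + 1 = i + K.sum → G g i' K' ≤ W) :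
    6 * u * G g i (0 ::ₘ K) ≤ 2 * G g i (1 ::ₘ K) + 3 * ((i : R) + K.sum) * W +
      seedTerm g i (0 ::ₘ K) := by
  have hmerge : mergeSum 0 K (fun m L => G g i (m ::ₘ L)) ≤ _ := mergeSum_zero_le hW (by
    rintro m L rfl
    exact h i (m ::ₘ L) (by simp) (by simp only [Multiset.sum_cons]; omega))
  have hshift : (2 * (i : R) + 1) * shiftDown (fun m => G g m K) (0 + i) ≤ 3 * i * W := by
    rw [zero_add]
    exact mul_shiftDown_le hW i fun m hm => h m K rfl (by omega)
  rw [hG.tail_constraint hu.ne' zero_le_one, insertTerm, zero_add]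
  linarith

end IsVirasoroSolution

/-- The majorant of the normalised amplitudes of genus `h + 1` with `n` indices, where `j` is the
difference between `3 h + n` and the sum of the indices and `t` stands for `1 / (6 u)`. -/
def ampBound (t : R) (h n j : ℕ) : R :=
  (9 / 4) ^ h * t ^ (2 * h + n + j) * (6 / 5) ^ j * 3 ^ n * ((2 * h + n + j)! / j !)

theorem ampBound_nonneg {t : R} (ht : 0 ≤ t) (h n j : ℕ) : 0 ≤ ampBound t h n j := by
  unfold ampBound
  positivity

theorem ampBound_succ_index (t : R) (h n j : ℕ) :
    ampBound t h (n + 1) j = 3 * t * (2 * h + n + j + 1) * ampBound t h n j := by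
  rw [ampBound, ampBound, show 2 * h + (n + 1) + j = (2 * h + n + j) + 1 by ring,
    Nat.factorial_succ]
  push_cast
  ring

theorem ampBound_succ_genus (t : R) (h n j : ℕ) :
    ampBound t (h + 1) n j = 3 / 4 * t * (2 * h + n + j + 2) * ampBound t h (n + 1) j := by
  rw [ampBound, ampBound, show 2 * (h + 1) + n + j = (2 * h + (n + 1) + j) + 1 by ring,
    Nat.factorial_succ]
  push_cast
  ring

theorem shiftDown_ampBound (t : R) (h n j : ℕ) :
    2 * t * (2 * h + n + j) * shiftDown (ampBound t h n) j = 5 / 3 * j * ampBound t h n j := by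
  rcases j with _ | j
  · simp
  · have hj : (j ! : R) ≠ 0 := by positivity
    have hj1 : (j : R) + 1 ≠ 0 := by positivity
    rw [shiftDown_succ, ampBound, ampBound, ← add_assoc, Nat.factorial_succ, Nat.factorial_succ]
    push_cast
    field_simp
    ring

/-- The inductive step of the majorant: `Y` is an amplitude with an index raised by one, `W` bounds
the amplitudes with one index less, and `Q` is the remaining part of the constraint. -/
theorem le_ampBound_of_constraint {u t c X Y E W D Q : R} {h n j : ℕ} (ht : 0 < t) (hc : 0 ≤ c)
    (hut : 6 * u * t = 1) (hE : 0 ≤ E) (hX : 6 * u * X ≤ 2 * Y + E * W + Q)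
    (hY : Y ≤ c * shiftDown (ampBound t h (n + 1)) j) (hW : W ≤ c * ampBound t h n j)
    (hQ : 3 * t * (2 * h + n + j + 1) * Q ≤ D * (c * ampBound t h (n + 1) j))
    (hED : 5 * j + E + D ≤ 3 * (2 * h + n + j + 1)) :
    X ≤ c * ampBound t h (n + 1) j := by
  have hshift := shiftDown_ampBound t h (n + 1) j
  have hindex := ampBound_succ_index t h n j
  have hV := ampBound_nonneg ht.le h (n + 1) j
  push_cast at hshift
  set V := ampBound t h (n + 1) j
  have hM : (0 : R) < 2 * h + n + j + 1 := by positivity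
  set M : R := 2 * h + n + j + 1 with hMdef
  refine le_of_mul_le_mul_left ?_ (mul_pos three_pos hM)
  calc 3 * M * X = 3 * M * t * (6 * u * X) := by linear_combination -(3 * M * X) * hut
    _ ≤ 3 * M * t * (2 * (c * shiftDown (ampBound t h (n + 1)) j) + E * (c * ampBound t h n j) +
        Q) := by
      gcongr
      exact hX.trans (by gcongr)
    _ = (5 * j + E) * (c * V) + 3 * t * M * Q := by
      rw [hindex] at hshift ⊢
      linear_combination 3 * c * hshift
    _ ≤ (5 * j + E + D) * (c * V) := by linarith
    _ ≤ 3 * M * (c * V) := by gcongr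

end Majorant

section FactorialConvolution

open Finset.HasAntidiagonal (antidiagonal mem_antidiagonal)

section ClosedForm

variable {R : Type*} [Field R] [CharZero R]

/-- The closed form of the convolution `∑ m.choose r * (p + r)! * (q + m - r)!`. -/
def factorialConv (R : Type*) [Field R] (p q m : ℕ) : R :=
  p ! * q ! * (p + q + 1 + m)! / (p + q + 1)!

theorem factorialConv_zero (p q : ℕ) : factorialConv R p q 0 = p ! * q ! := by
  have : ((p + q + 1)! : R) ≠ 0 := mod_cast Nat.factorial_ne_zero _
  rw [factorialConv, add_zero, mul_div_assoc, div_self this, mul_one]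

theorem factorialConv_succ (p q m : ℕ) :
    factorialConv R p q (m + 1) = factorialConv R (p + 1) q m + factorialConv R p (q + 1) m := by
  have h : ((p + q + 1)! : R) ≠ 0 := mod_cast Nat.factorial_ne_zero _
  have h' : ((p : R) + q + 1 + 1) ≠ 0 := mod_cast Nat.succ_ne_zero (p + q + 1)
  simp only [factorialConv, show p + 1 + q + 1 = (p + q + 1) + 1 by ring,
    show p + (q + 1) + 1 = (p + q + 1) + 1 by ring, Nat.factorial_succ p, Nat.factorial_succ q,
    Nat.factorial_succ (p + q + 1), show p + q + 1 + (m + 1) = p + q + 1 + 1 + m by ring]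
  push_cast
  field_simp
  ring

theorem sum_choose_mul_factorial (p q m : ℕ) :
    ∑ r ∈ antidiagonal m, (m.choose r.1 : R) * ((p + r.1)! * (q + r.2)!) =
      factorialConv R p q m := by
  induction m generalizing p q with
  | zero => simp [factorialConv_zero]
  | succ m ih =>
    rw [Finset.sum_antidiagonal_choose_succ_mul (fun a b => ((p + a)! : R) * (q + b)!) m,
      factorialConv_succ, ← ih (p + 1) q, ← ih p (q + 1), add_comm]
    congr 1
    · refine Finset.sum_congr rfl fun r hr => ?_
      rw [Nat.choose_symm_of_eq_add (mem_antidiagonal.mp hr).symm,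
        show p + 1 + r.1 = p + (r.1 + 1) by ring]
    · refine Finset.sum_congr rfl fun r _ => ?_
      rw [show q + 1 + r.2 = q + (r.2 + 1) by ring]

theorem splitSum_factorialConv {α : Type*} (K : Multiset α) (p q m : ℕ) :
    splitSum K (fun I J => factorialConv R (p + I.card) (q + J.card) m) =
      factorialConv R p q (K.card + m) := by
  induction K using Multiset.induction_on generalizing m with
  | empty => simp
  | cons a K ih =>
    rw [splitSum_cons, ← splitSum_add, Multiset.card_cons,
      show K.card + 1 + m = K.card + (m + 1) by ring, ← ih]
    refine splitSum_congr fun I J _ => ?_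
    rw [factorialConv_succ, Multiset.card_cons, Multiset.card_cons]
    rfl

end ClosedForm

theorem factorial_succ_mul_factorial_succ_le (a b : ℕ) :
    (a + 1)! * (b + 1)! ≤ (a + b + 1)! := by
  induction b with
  | zero => simp
  | succ b ih =>
    rw [Nat.factorial_succ (b + 1), show a + (b + 1) + 1 = (a + b + 1) + 1 by ring,
      Nat.factorial_succ (a + b + 1)]
    calc (a + 1)! * ((b + 1 + 1) * (b + 1)!) = (b + 1 + 1) * ((a + 1)! * (b + 1)!) := by ring
      _ ≤ (a + b + 1 + 1) * (a + b + 1)! := Nat.mul_le_mul (by omega) ih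

variable {R : Type*} [Field R] [LinearOrder R] [IsStrictOrderedRing R]

theorem factorialConv_odd_le (a b m : ℕ) :
    factorialConv R (2 * a + 1) (2 * b + 1) m ≤
      (2 * (a + b) + 3 + m)! / ((2 * (a + b) + 3) * (2 * (a + b) + 2)) := by
  have hle : ((2 * a + 1)! * (2 * b + 1)! : R) ≤ (2 * a + 2 * b + 1)! :=
    mod_cast factorial_succ_mul_factorial_succ_le (2 * a) (2 * b)
  rw [factorialConv, show 2 * a + 1 + (2 * b + 1) + 1 = (2 * a + 2 * b + 1) + 1 + 1 by ring,
    Nat.factorial_succ (2 * a + 2 * b + 1 + 1), Nat.factorial_succ (2 * a + 2 * b + 1),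
    show 2 * (a + b) + 3 + m = 2 * a + 2 * b + 1 + 1 + 1 + m by ring]
  push_cast
  rw [div_le_div_iff₀ (by positivity) (by positivity)]
  calc _ ≤ ((2 * a + 2 * b + 1)! : R) * (2 * a + 2 * b + 1 + 1 + 1 + m)! *
        ((2 * (a + b) + 3) * (2 * (a + b) + 2)) := by gcongr
    _ = _ := by ring

theorem sum_ampBound_mul_ampBound (t : R) (a b n m j : ℕ) :
    ∑ r ∈ antidiagonal j, ampBound t a (n + 1) r.1 * ampBound t b (m + 1) r.2 =
      (9 / 4) ^ (a + b) * t ^ (2 * (a + b) + (n + m) + 2 + j) * (6 / 5) ^ j * 3 ^ (n + m + 2) /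
        j ! * factorialConv R (2 * a + 1 + n) (2 * b + 1 + m) j := by
  rw [← sum_choose_mul_factorial, Finset.mul_sum]
  refine Finset.sum_congr rfl fun r hr => ?_
  have hr' := mem_antidiagonal.mp hr
  have hchoose : ((j.choose r.1 : ℕ) : R) = j ! / (r.1 ! * r.2 !) := by
    rw [← hr', Nat.cast_add_choose]
  rw [hchoose, ampBound, ampBound, ← hr', show 2 * a + (n + 1) + r.1 = 2 * a + 1 + n + r.1 by ring,
    show 2 * b + (m + 1) + r.2 = 2 * b + 1 + m + r.2 by ring]
  have h1 : (r.1 ! : R) ≠ 0 := by positivity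
  have h2 : (r.2 ! : R) ≠ 0 := by positivity
  have h3 : ((r.1 + r.2)! : R) ≠ 0 := by positivity
  field_simp
  ring

theorem splitSum_ampBound_le {α : Type*} {t : R} (ht : 0 ≤ t) (a b : ℕ) (K : Multiset α) (j : ℕ) :
    splitSum K (fun I J => ∑ r ∈ antidiagonal j,
        ampBound t a (I.card + 1) r.1 * ampBound t b (J.card + 1) r.2) ≤
      (9 / 4) ^ (a + b) * t ^ (2 * (a + b) + K.card + 2 + j) * (6 / 5) ^ j * 3 ^ (K.card + 2) /
        j ! * ((2 * (a + b) + 3 + (K.card + j))! / ((2 * (a + b) + 3) * (2 * (a + b) + 2))) := by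
  trans (9 / 4) ^ (a + b) * t ^ (2 * (a + b) + K.card + 2 + j) * (6 / 5) ^ j * 3 ^ (K.card + 2) /
    j ! * factorialConv R (2 * a + 1) (2 * b + 1) (K.card + j)
  · rw [← splitSum_factorialConv, ← splitSum_mul_left]
    refine (splitSum_congr fun I J hIJ => ?_).le
    rw [sum_ampBound_mul_ampBound, ← hIJ, Multiset.card_add]
  · gcongr
    exact factorialConv_odd_le a b _

theorem sum_splitSum_ampBound_le {α : Type*} {t : R} (ht : 0 < t) (h : ℕ) (K : Multiset α)
    (j : ℕ) :
    t * (2 * h + 3) * ∑ q ∈ antidiagonal h, splitSum K (fun I J => ∑ r ∈ antidiagonal j,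
        ampBound t q.1 (I.card + 1) r.1 * ampBound t q.2 (J.card + 1) r.2) ≤
      2 / 3 * ampBound t (h + 1) (K.card + 1) j := by
  calc _ ≤ t * (2 * h + 3) * (antidiagonal h).card • ((9 / 4) ^ h *
        t ^ (2 * h + K.card + 2 + j) * (6 / 5) ^ j * 3 ^ (K.card + 2) / j ! *
          ((2 * h + 3 + (K.card + j))! / ((2 * h + 3) * (2 * h + 2)))) := by
        gcongr
        refine Finset.sum_le_card_nsmul _ _ _ fun q hq => ?_
        have hq' : (q.1 : R) + q.2 = h := mod_cast mem_antidiagonal.mp hq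
        rw [← hq', ← mem_antidiagonal.mp hq]
        exact splitSum_ampBound_le ht.le q.1 q.2 K j
    _ = 2 / 3 * ampBound t (h + 1) (K.card + 1) j := by
      rw [Finset.Nat.card_antidiagonal, ampBound, nsmul_eq_mul,
        show 2 * (h + 1) + (K.card + 1) + j = 2 * h + 3 + (K.card + j) by ring]
      have : (j ! : R) ≠ 0 := by positivity
      push_cast
      field_simp
      ring

end FactorialConvolution

section AmplitudeBounds

open Finset.HasAntidiagonal (antidiagonal mem_antidiagonal)

theorem two_mul_card_le_sum {K : Multiset ℕ} (h : ∀ k ∈ K, 2 ≤ k) : 2 * K.card ≤ K.sum := by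
  have hle := Multiset.card_nsmul_le_sum h
  rw [smul_eq_mul] at hle
  omega

section HighIndices

variable {R : Type*} [Field R] {u : R} {G : ℕ → ℕ → Multiset ℕ → R}
  (hG : IsVirasoroSolution u G) {K : Multiset ℕ}

include hG

namespace IsVirasoroSolution

theorem eq_zero_of_forall_two_le (hK : ∀ k ∈ K, 2 ≤ k) (μ : ℕ) {I : Multiset ℕ} (hI : I ≤ K) :
    G 0 μ I = 0 := by
  have := two_mul_card_le_sum fun k hk => hK k (Multiset.mem_of_le hI hk)
  exact hG.eq_zero_of_lt 0 μ I (by omega)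

theorem productTerm_eq_of_forall_two_le (hK : ∀ k ∈ K, 2 ≤ k) (h μ ν : ℕ) :
    productTerm G G (h + 2) μ ν K = ∑ q ∈ antidiagonal h,
      splitSum K fun I J => G (q.1 + 1) μ I * G (q.2 + 1) ν J := by
  have hleft : splitSum K (fun I J => G 0 μ I * G (h + 1 + 1) ν J) = 0 :=
    (splitSum_congr fun I J hIJ => by
      rw [hG.eq_zero_of_forall_two_le hK μ (hIJ ▸ Multiset.le_add_right I J), zero_mul]).trans
      (splitSum_const_zero K)
  have hright : splitSum K (fun I J => G (h + 1 + 1) μ I * G 0 ν J) = 0 :=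
    (splitSum_congr fun I J hIJ => by
      rw [hG.eq_zero_of_forall_two_le hK ν (hIJ ▸ Multiset.le_add_left J I), mul_zero]).trans
      (splitSum_const_zero K)
  rw [productTerm, Finset.Nat.sum_antidiagonal_succ, Finset.Nat.sum_antidiagonal_succ', hleft,
    hright, zero_add, zero_add]

end IsVirasoroSolution

end HighIndices

variable {R : Type*} [Field R] [LinearOrder R] [IsStrictOrderedRing R]

/-- Comparison of two convolutions of which the first has terms supported in `μ + x ≤ X` and
`ν + y ≤ Y`; the summation indices of the second measure the distance to these bounds. -/
theorem sum_antidiagonal_le_of_shift {A B v w : ℕ → R} {x X y Y i j : ℕ}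
    (hB : ∀ μ, 0 ≤ B μ) (hv : ∀ r, 0 ≤ v r) (hw : ∀ r, 0 ≤ w r)
    (hA0 : ∀ μ, X < μ + x → A μ = 0) (hB0 : ∀ μ, Y < μ + y → B μ = 0)
    (hAv : ∀ μ r, μ + x + r = X → A μ ≤ v r) (hBw : ∀ μ r, μ + y + r = Y → B μ ≤ w r)
    (hXY : X + Y = x + y + i + j) :
    ∑ p ∈ antidiagonal i, A p.1 * B p.2 ≤ ∑ r ∈ antidiagonal j, v r.1 * w r.2 := by
  set s := (antidiagonal i).filter fun p : ℕ × ℕ => p.1 + x ≤ X ∧ p.2 + y ≤ Y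
  have hs (p : ℕ × ℕ) (hp : p ∈ s) : p.1 + p.2 = i ∧ p.1 + x ≤ X ∧ p.2 + y ≤ Y :=
    ⟨mem_antidiagonal.mp (Finset.mem_filter.mp hp).1, (Finset.mem_filter.mp hp).2⟩
  let reflect : ℕ × ℕ → ℕ × ℕ := fun p => (X - x - p.1, Y - y - p.2)
  calc ∑ p ∈ antidiagonal i, A p.1 * B p.2 = ∑ p ∈ s, A p.1 * B p.2 := by
        refine (Finset.sum_filter_of_ne fun p _ hne => ?_).symm
        constructor
        · by_contra h
          exact hne (by rw [hA0 _ (by omega), zero_mul])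
        · by_contra h
          exact hne (by rw [hB0 _ (by omega), mul_zero])
    _ ≤ ∑ p ∈ s, v (reflect p).1 * w (reflect p).2 := by
        refine Finset.sum_le_sum fun p hp => ?_
        obtain ⟨-, h1, h2⟩ := hs p hp
        exact mul_le_mul (hAv _ _ (by simp only [reflect]; omega))
          (hBw _ _ (by simp only [reflect]; omega)) (hB _) (hv _)
    _ = ∑ r ∈ s.image reflect, v r.1 * w r.2 := by
        refine (Finset.sum_image (f := fun r : ℕ × ℕ => v r.1 * w r.2) fun p hp q hq hpq => ?_).symm
        obtain ⟨-, h1, h2⟩ := hs p hp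
        obtain ⟨-, h1', h2'⟩ := hs q hq
        simp only [reflect, Prod.mk.injEq] at hpq
        ext <;> omega
    _ ≤ ∑ r ∈ antidiagonal j, v r.1 * w r.2 := by
        refine Finset.sum_le_sum_of_subset_of_nonneg (fun r hr => ?_)
          fun r _ _ => mul_nonneg (hv _) (hw _)
        obtain ⟨p, hp, rfl⟩ := Finset.mem_image.mp hr
        obtain ⟨h0, h1, h2⟩ := hs p hp
        simp only [reflect, mem_antidiagonal]
        omega

namespace IsVirasoroSolution

variable {u t : R} {G : ℕ → ℕ → Multiset ℕ → R} (hG : IsVirasoroSolution u G)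

include hG

section GenusZero

theorem genus_zero_three_eq (hut : 6 * u * t = 1) : G 0 0 {0, 0} = t := by
  have hraise : G 0 1 {0, 0} = 0 := hG.eq_zero_of_lt _ _ _ (by simp)
  have hmerge : mergeSum 0 {0, 0} (G 0) = 0 := mergeSum_eq_zero fun m k L hm hL => by
    have hk : k ∈ ({0, 0} : Multiset ℕ) := hL ▸ Multiset.mem_cons_self k L
    obtain rfl : k = 0 := by simpa using hk
    omega
  have hhead := hG.constraint 0 0 {0, 0}
  rw [hraise, hmerge, cutTerm, pairSum_zero, seedTerm_zero, if_pos ⟨rfl, rfl⟩] at hhead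
  linear_combination t * hhead - G 0 0 {0, 0} * hut

/-- Some index of the tail vanishes, since the sum of the indices is at most their number minus
three; the string equation removes it. -/
theorem genus_zero_le (hu : 0 < u) (hut : 6 * u * t = 1) (i : ℕ) (K : Multiset ℕ) (c j : ℕ)
    (hc : K.card = c + 2) (hj : i + K.sum + j = c) : G 0 i K ≤ t * ampBound t 0 c j := by
  have ht : 0 < t := pos_of_mul_pos_right (hut ▸ one_pos) (by positivity)
  suffices key : ∀ g i K, g = 0 → ∀ c j, Multiset.card K = c + 2 → i + K.sum + j = c →
      G g i K ≤ t * ampBound t 0 c j from key 0 i K rfl c j hc hj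
  intro g i K
  induction g, i, K using amplitude_induction with
  | base g i K h => intros; omega
  | step g i K ih_small ih_large =>
    rintro rfl c j hc hj
    obtain ⟨L, rfl⟩ := exists_cons_zero_of_sum_lt (K := K) (by omega)
    simp only [Multiset.sum_cons, zero_add, Multiset.card_cons] at hj hc
    rcases c with _ | c
    · obtain ⟨rfl, hsum, rfl⟩ : i = 0 ∧ L.sum = 0 ∧ j = 0 := by omega
      obtain ⟨l, rfl⟩ := Multiset.card_eq_one.mp (show L.card = 1 by omega)
      obtain rfl : l = 0 := by simpa using hsum
      exact (hG.genus_zero_three_eq hut).le.trans (by simp [ampBound])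
    have hW := mul_nonneg ht.le (ampBound_nonneg ht.le 0 c j)
    have hX := hG.string_equation_le hu (g := 0) (i := i) (K := L) hW fun i' K' h1 h2 =>
      ih_small 0 i' K' (by rw [Multiset.card_cons]; omega) rfl c j (by omega) (by omega)
    have hY : G 0 i (1 ::ₘ L) ≤ t * shiftDown (ampBound t 0 (c + 1)) j := by
      rcases j with _ | j
      · rw [hG.eq_zero_of_lt _ _ _ (by simp; omega), shiftDown_zero, mul_zero]
      · exact ih_large i (1 ::ₘ L) (by simp) (by simp) rfl (c + 1) j (by simp; omega)
          (by simp; omega)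
    have hseed : (seedTerm 0 i (0 ::ₘ L) : R) = 0 := by
      rw [seedTerm_cons, if_neg]
      rintro ⟨-, -, -, rfl⟩
      simp at hc
    refine le_ampBound_of_constraint (D := 0) ht ht.le hut (by positivity) hX hY le_rfl
      (by rw [hseed]; simp) ?_
    have hjR : (i : R) + L.sum + j = c + 1 := mod_cast hj
    rw [Nat.cast_zero]
    linarith [(j.cast_nonneg : (0 : R) ≤ j)]

end GenusZero

section PositiveGenus

variable {h i j : ℕ} {K : Multiset ℕ}

theorem pairSum_productTerm_le (hu : 0 < u) (ht : 0 < t) (hK : ∀ k ∈ K, 2 ≤ k)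
    (hj : i + K.sum + j = 3 * h + 2 + K.card)
    (ih : ∀ g' i' K', 2 * g' + K'.card < 2 * (h + 2) + K.card → ∀ h' j', g' = h' + 1 →
      i' + K'.sum + j' + 2 = 3 * g' + K'.card → G g' i' K' ≤ ampBound t h' (K'.card + 1) j') :
    t * (2 * h + 3) * pairSum (fun μ ν => productTerm G G (h + 2) μ ν K) (i + 2) ≤
      2 / 3 * ampBound t (h + 1) (K.card + 1) j := by
  refine le_trans ?_ (sum_splitSum_ampBound_le ht h K j)
  gcongr
  simp only [hG.productTerm_eq_of_forall_two_le hK, pairSum_add_two]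
  rw [Finset.sum_comm]
  refine Finset.sum_le_sum fun q hq => ?_
  rw [← splitSum_sum]
  refine splitSum_mono fun I J hIJ => ?_
  rw [mem_antidiagonal] at hq
  have hcard : I.card + J.card = K.card := by rw [← hIJ, Multiset.card_add]
  have hsum : I.sum + J.sum = K.sum := by rw [← hIJ, Multiset.sum_add]
  exact sum_antidiagonal_le_of_shift (v := ampBound t q.1 (I.card + 1))
    (w := ampBound t q.2 (J.card + 1)) (x := I.sum + 2) (X := 3 * (q.1 + 1) + I.card)
    (y := J.sum + 2) (Y := 3 * (q.2 + 1) + J.card) (fun μ => hG.nonneg hu _ _ _)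
    (fun r => ampBound_nonneg ht.le _ _ _) (fun r => ampBound_nonneg ht.le _ _ _)
    (fun μ hμ => hG.eq_zero_of_lt _ _ _ (by omega))
    (fun μ hμ => hG.eq_zero_of_lt _ _ _ (by omega))
    (fun μ r hr => ih _ μ I (by omega) q.1 r rfl (by omega))
    (fun μ r hr => ih _ μ J (by omega) q.2 r rfl (by omega)) (by omega)

theorem cutTerm_le (hu : 0 < u) (ht : 0 < t) (hK : ∀ k ∈ K, 2 ≤ k)
    (hj : i + K.sum + j = 3 * h + 2 + K.card)
    (ih : ∀ g' i' K', 2 * g' + K'.card < 2 * (h + 2) + K.card → ∀ h' j', g' = h' + 1 →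
      i' + K'.sum + j' + 2 = 3 * g' + K'.card → G g' i' K' ≤ ampBound t h' (K'.card + 1) j') :
    3 * t * (2 * h + K.card + j + 3) * cutTerm G (h + 2) (i + 2) K ≤
      (4 * i + 10) * ampBound t (h + 1) (K.card + 1) j := by
  set M : R := 2 * h + K.card + j + 3
  have _hM : 0 ≤ M := by positivity
  have hloop : t * M * pairSum (fun μ ν => loopTerm G (h + 2) μ ν K) (i + 2) ≤
      (i + 1) * (4 / 3 * ampBound t (h + 1) (K.card + 1) j) := by
    have hgenus : 4 / 3 * ampBound t (h + 1) (K.card + 1) j =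
        t * M * ampBound t h (K.card + 2) j := by
      rw [ampBound_succ_genus]
      push_cast
      ring
    rw [hgenus, mul_left_comm, pairSum_add_two]
    gcongr
    refine (Finset.sum_le_card_nsmul _ _ (ampBound t h (K.card + 2) j) fun p hp => ?_).trans_eq
      (by simp [nsmul_eq_mul])
    rw [mem_antidiagonal] at hp
    simpa [loopTerm] using
      ih (h + 1) p.1 (p.2 ::ₘ K) (by simp; omega) h j rfl (by simp; omega)
  have hproduct := hG.pairSum_productTerm_le hu ht hK hj ih
  have hproduct0 : 0 ≤ pairSum (fun μ ν => productTerm G G (h + 2) μ ν K) (i + 2) :=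
    pairSum_nonneg _ fun μ ν _ =>
      productTerm_nonneg hG.disk_eq_zero (fun g' i' K' _ => hG.nonneg hu g' i' K') μ ν
  have hM3 : M ≤ 3 * (2 * h + 3) := by
    have hcard := two_mul_card_le_sum hK
    have : (K.card : R) + j ≤ 3 * h + 2 := mod_cast (show K.card + j ≤ 3 * h + 2 by omega)
    linarith [(h.cast_nonneg : (0 : R) ≤ h)]
  have hproduct' : t * M * pairSum (fun μ ν => productTerm G G (h + 2) μ ν K) (i + 2) ≤
      2 * ampBound t (h + 1) (K.card + 1) j := by
    calc _ ≤ t * (3 * (2 * h + 3)) *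
          pairSum (fun μ ν => productTerm G G (h + 2) μ ν K) (i + 2) := by gcongr
      _ ≤ _ := by linarith
  simp only [cutTerm, quadTerm, pairSum_add]
  linarith

theorem cutTerm_add_seedTerm_le (hu : 0 < u) (ht : 0 < t) (hK : ∀ k ∈ K, 2 ≤ k)
    (hj : i + K.sum + j = 3 * h + 1 + K.card)
    (ih : ∀ g' i' K', 2 * g' + K'.card < 2 * (h + 1) + K.card → ∀ h' j', g' = h' + 1 →
      i' + K'.sum + j' + 2 = 3 * g' + K'.card → G g' i' K' ≤ ampBound t h' (K'.card + 1) j') :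
    3 * t * (2 * h + K.card + j + 1) *
        (1 / 2 * cutTerm G (h + 1) i K + seedTerm (h + 1) i K) ≤
      (2 * i + 1) * ampBound t h (K.card + 1) j := by
  have hV := ampBound_nonneg ht.le h (K.card + 1) j
  have hcard := two_mul_card_le_sum hK
  match i with
  | 0 =>
    rw [cutTerm, pairSum_zero, seedTerm_zero, if_neg (by omega)]
    simpa using hV
  | 1 =>
    rw [cutTerm, pairSum_one, seedTerm_one]
    split_ifs with hseed
    · obtain ⟨h0, rfl⟩ := hseed
      obtain rfl : h = 0 := by omega
      obtain rfl : j = 0 := by simp at hj; omega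
      have hval : ampBound t 0 1 0 = 3 * t := by simp [ampBound, mul_comm]
      rw [Multiset.card_zero, zero_add, hval]
      push_cast
      linarith
    · simp only [mul_zero, add_zero]
      positivity
  | i + 2 =>
    obtain ⟨h, rfl⟩ : ∃ h', h = h' + 1 := ⟨h - 1, by omega⟩
    have hcut := hG.cutTerm_le hu ht (j := j) (i := i) (h := h) hK (by omega) ih
    rw [seedTerm_add_two]
    push_cast at hcut ⊢
    linarith

theorem positive_genus_le_of_forall_two_le (hu : 0 < u) (ht : 0 < t) (hut : 6 * u * t = 1)
    (hK : ∀ k ∈ K, 2 ≤ k) (hj : i + K.sum + j = 3 * h + 1 + K.card)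
    (ih : ∀ g' i' K', 2 * g' + K'.card < 2 * (h + 1) + K.card → ∀ h' j', g' = h' + 1 →
      i' + K'.sum + j' + 2 = 3 * g' + K'.card → G g' i' K' ≤ ampBound t h' (K'.card + 1) j')
    (hsmall : ∀ i' K', K'.card + 1 = K.card → i' + K'.sum + 1 = i + K.sum →
      G (h + 1) i' K' ≤ ampBound t h K.card j)
    (hraise : G (h + 1) (i + 1) K ≤ shiftDown (ampBound t h (K.card + 1)) j) :
    G (h + 1) i K ≤ ampBound t h (K.card + 1) j := by
  have hW := ampBound_nonneg ht.le h K.card j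
  have hQ := hG.cutTerm_add_seedTerm_le hu ht hK hj ih
  have hX := hG.constraint_le hW hsmall
  rw [← one_mul (ampBound t h (K.card + 1) j)] at hQ ⊢
  rw [← one_mul (shiftDown _ _)] at hraise
  refine le_ampBound_of_constraint (D := 2 * (i : R) + 1) ht zero_le_one hut (by positivity) hX
    hraise (one_mul _).ge hQ ?_
  have hjR : (i : R) + K.sum + j = 3 * h + 1 + K.card := mod_cast hj
  linarith

theorem positive_genus_cons_le (hu : 0 < u) (ht : 0 < t) (hut : 6 * u * t = 1) {a : ℕ}
    (ha : a ≤ 1) (hj : i + (a + K.sum) + j = 3 * h + 2 + K.card)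
    (hsmall : ∀ i' K', K'.card = K.card → i' + K'.sum + 1 = i + (a + K.sum) →
      G (h + 1) i' K' ≤ ampBound t h (K.card + 1) j)
    (hraise : G (h + 1) i ((a + 1) ::ₘ K) ≤ shiftDown (ampBound t h (K.card + 2)) j) :
    G (h + 1) i (a ::ₘ K) ≤ ampBound t h (K.card + 2) j := by
  have hW := ampBound_nonneg ht.le h (K.card + 1) j
  have hX := hG.tail_constraint_le hu ha hW hsmall
  rw [seedTerm_cons, if_neg (by omega)] at hX
  rw [← one_mul (ampBound _ _ _ _)]
  rw [← one_mul (shiftDown _ _)] at hraise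
  refine le_ampBound_of_constraint (D := 0) ht zero_le_one hut (by positivity) hX hraise
    (one_mul _).ge (by simp) ?_
  have hjR : (i : R) + (a + K.sum) + j = 3 * h + 2 + K.card := mod_cast hj
  rw [Nat.cast_succ]
  linarith [(a.cast_nonneg : (0 : R) ≤ a)]

/-- An index `0` or `1` of the tail is removed by the string or dilaton equation; otherwise the
constraint at the first index is used. -/
theorem positive_genus_le (hu : 0 < u) (hut : 6 * u * t = 1) (h i : ℕ) (K : Multiset ℕ) (j : ℕ)
    (hj : i + K.sum + j = 3 * h + 1 + K.card) :
    G (h + 1) i K ≤ ampBound t h (K.card + 1) j := by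
  have ht : 0 < t := pos_of_mul_pos_right (hut ▸ one_pos) (by positivity)
  suffices key : ∀ g i K h j, g = h + 1 → i + Multiset.sum K + j + 2 = 3 * g + K.card →
      G g i K ≤ ampBound t h (K.card + 1) j from key (h + 1) i K h j rfl (by omega)
  intro g i K
  induction g, i, K using amplitude_induction with
  | base g i K h => intros; omega
  | step g i K ih_small ih_large =>
    rintro h j rfl hj
    have hsmall (i' : ℕ) (K' : Multiset ℕ) (hcard : K'.card + 1 = K.card)
        (hsum : i' + K'.sum + 1 = i + K.sum) : G (h + 1) i' K' ≤ ampBound t h K.card j := by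
      rw [← hcard]
      exact ih_small _ i' K' (by omega) h j rfl (by omega)
    have hraise (i' : ℕ) (K' : Multiset ℕ) (hcard : K'.card = K.card)
        (hsum : i' + K'.sum = i + K.sum + 1) :
        G (h + 1) i' K' ≤ shiftDown (ampBound t h (K.card + 1)) j := by
      rcases j with _ | j
      · rw [hG.eq_zero_of_lt _ i' K' (by omega), shiftDown_zero]
      · exact hcard ▸ ih_large i' K' hcard (by omega) h j rfl (by omega)
    by_cases hK : ∀ k ∈ K, 2 ≤ k
    · refine hG.positive_genus_le_of_forall_two_le hu ht hut hK (by omega) ih_small hsmall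
        (hraise _ _ rfl (by omega))
    · push Not at hK
      obtain ⟨a, ha, ha2⟩ := hK
      obtain ⟨L, rfl⟩ := Multiset.exists_cons_of_mem ha
      simp only [Multiset.sum_cons, Multiset.card_cons, Nat.add_right_cancel_iff] at *
      exact hG.positive_genus_cons_le hu ht hut (by omega) (by omega) hsmall
        (hraise _ _ (by simp) (by simp; omega))

end PositiveGenus

end IsVirasoroSolution

end AmplitudeBounds

section PainleveICurve

theorem ofPowerSeries_monomial {R : Type*} [Semiring R] (n : ℕ) (c : R) :
    HahnSeries.ofPowerSeries ℤ R (PowerSeries.monomial n c) = HahnSeries.single (n : ℤ) c := by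
  ext z
  rw [PowerSeries.coeff_coe, HahnSeries.coeff_single]
  split_ifs with h1 h2 h2
  · omega
  · rfl
  · rw [PowerSeries.coeff_monomial, if_pos (by omega)]
  · rw [PowerSeries.coeff_monomial, if_neg (by omega)]

theorem coeff_inv_sq_C_sub_X {K : Type*} [Field K] (a : Kˣ) (n : ℕ) :
    PowerSeries.coeff n ((PowerSeries.C (a : K) - PowerSeries.X) ^ 2)⁻¹ =
      (n + 1) * (a : K)⁻¹ ^ (n + 2) := by
  have hinv : ((PowerSeries.C (a : K) - PowerSeries.X) ^ 2)⁻¹ =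
      PowerSeries.invUnitsSub a ^ 2 := by
    rw [PowerSeries.inv_eq_iff_mul_eq_one (by simp), ← mul_pow, PowerSeries.invUnitsSub_mul_sub,
      one_pow]
  rw [hinv, sq, PowerSeries.coeff_mul, Finset.sum_congr rfl (g := fun _ => (a : K)⁻¹ ^ (n + 2)),
    Finset.sum_const, Finset.Nat.card_antidiagonal, nsmul_eq_mul, Nat.cast_succ]
  intro p hp
  rw [PowerSeries.coeff_invUnitsSub, PowerSeries.coeff_invUnitsSub, one_divp, one_divp,
    Units.val_inv_eq_inv_val, Units.val_inv_eq_inv_val, Units.val_pow_eq_pow_val,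
    Units.val_pow_eq_pow_val, ← inv_pow, ← inv_pow, ← pow_add,
    ← Finset.HasAntidiagonal.mem_antidiagonal.mp hp]
  congr 1
  ring

variable {R : Type*} [Field R]

/-- The weight `(2k+1)!!` of an index `k`. -/
def oddDoubleFactorial (k : ℕ) : R := ((2 * k + 1)‼ : ℕ)

/-- The coefficient `θ_m` of `z^{2m-2}` in `θ` for the Painlevé I curve. The index `m` is an integer
so that residues become coefficients without case distinctions; `θ_m = 0` for `m < 0`. -/
noncomputable def painleveITheta (u : R) (m : ℤ) : R := (painleveI u).theta.coeff (2 * m - 2)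

theorem derivative_painleveI_x (u : R) :
    PowerSeries.derivative R (painleveI u).x = 2 * PowerSeries.X := by
  simp [OnePointCurve.x, PowerSeries.derivative_C, PowerSeries.derivative_X]

theorem painleveI_theta_eq_div (u : R) : (painleveI u).theta =
    -2 / (HahnSeries.single (2 : ℤ) (-12 * u) + HahnSeries.single 4 4) := by
  have odd_y : PowerSeries.evalNegHom (painleveI u).y = -(painleveI u).y := by
    ext n
    simp only [painleveI, PowerSeries.evalNegHom, PowerSeries.coeff_rescale, map_sub, map_neg,
      PowerSeries.coeff_C_mul, PowerSeries.coeff_X_pow, PowerSeries.coeff_X]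
    rcases eq_or_ne n 3 with rfl | h3
    · norm_num
    rcases eq_or_ne n 1 with rfl | h1
    · norm_num
    simp [h3, h1]
  have denominator : ((painleveI u).y - PowerSeries.evalNegHom (painleveI u).y) *
      PowerSeries.derivative R (painleveI u).x =
      PowerSeries.monomial 2 (-12 * u) + PowerSeries.monomial 4 4 := by
    rw [odd_y, derivative_painleveI_x, painleveI, PowerSeries.monomial_eq_C_mul_X_pow,
      PowerSeries.monomial_eq_C_mul_X_pow]
    simp only [map_mul, map_neg, map_ofNat]
    ring
  rw [OnePointCurve.theta, denominator, map_add, ofPowerSeries_monomial, ofPowerSeries_monomial]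
  rfl

theorem painleveI_omega02 (u : R) : (painleveI u).omega02 =
    ((PowerSeries.C (HahnSeries.single (1 : ℤ) (1 : R)) - PowerSeries.X) ^ 2)⁻¹ := by
  refine add_eq_left.mpr ?_
  ext1 n
  rw [PowerSeries.coeff_mk, map_zero]
  exact map_zero (HahnSeries.ofPowerSeries ℤ R)

theorem coe_e (i : ℕ) : ((OnePointCurve.e R i : R⟦X⟧) : R⸨X⸩) =
    HahnSeries.single (2 * (i : ℤ) + 1) (1 / oddDoubleFactorial i) := by
  rw [OnePointCurve.e, ofPowerSeries_monomial]
  push_cast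
  rfl

theorem coe_de (i : ℕ) : ((OnePointCurve.de R i : R⟦X⟧) : R⸨X⸩) =
    HahnSeries.single (2 * (i : ℤ)) ((2 * (i : R) + 1) / oddDoubleFactorial i) := by
  have hde : OnePointCurve.de R i =
      PowerSeries.monomial (2 * i) ((2 * (i : R) + 1) / oddDoubleFactorial i) := by
    ext n
    rw [OnePointCurve.de, OnePointCurve.e, PowerSeries.coeff_derivative, PowerSeries.coeff_monomial,
      PowerSeries.coeff_monomial]
    by_cases h : n = 2 * i
    · rw [if_pos (by omega), if_pos h, h]
      rw [oddDoubleFactorial]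
      push_cast
      ring
    · rw [if_neg (by omega), if_neg h, zero_mul]
  rw [hde, ofPowerSeries_monomial]
  push_cast
  rfl

variable [CharZero R] {u : R}

theorem painleveI_theta_mul (hu : u ≠ 0) : (painleveI u).theta *
    (HahnSeries.single (2 : ℤ) (-12 * u) + HahnSeries.single 4 4) = HahnSeries.single 0 (-2) := by
  rw [painleveI_theta_eq_div, div_mul_cancel₀]
  · rw [← HahnSeries.C_apply, map_neg, map_ofNat]
  · intro h
    simpa [hu] using congrArg (fun f => HahnSeries.coeff f 2) h

theorem painleveITheta_recursion (hu : u ≠ 0) (m : ℤ) :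
    6 * u * painleveITheta u m - 2 * painleveITheta u (m - 1) = if m = 0 then 1 else 0 := by
  have h := congrArg (fun f => HahnSeries.coeff f (2 * m)) (painleveI_theta_mul hu)
  simp only [mul_add, HahnSeries.coeff_add, HahnSeries.coeff_mul_single,
    HahnSeries.coeff_single] at h
  rw [painleveITheta, painleveITheta, show 2 * (m - 1) - 2 = 2 * m - 4 by ring]
  split_ifs at h ⊢ with hm hm' hm'
  · linear_combination (-1 / 2) * h
  · omega
  · omega
  · linear_combination (-1 / 2) * h

theorem painleveITheta_of_neg (hu : u ≠ 0) {m : ℤ} (hm : m < 0) : painleveITheta u m = 0 := by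
  have hmul := painleveI_theta_mul hu
  have hne := hmul.trans_ne (HahnSeries.single_ne_zero (by norm_num))
  have horder := congrArg HahnSeries.order hmul
  rw [HahnSeries.order_mul (left_ne_zero_of_mul hne) (right_ne_zero_of_mul hne),
    HahnSeries.order_single (by norm_num)] at horder
  have hdenom : (HahnSeries.single (2 : ℤ) (-12 * u) + HahnSeries.single 4 4).order ≤ 2 :=
    HahnSeries.order_le_of_coeff_ne_zero (by simp [hu])
  exact HahnSeries.coeff_eq_zero_of_lt_order (by omega)

theorem painleveITheta_zero (hu : u ≠ 0) : painleveITheta u 0 = 1 / (6 * u) := by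
  have h := painleveITheta_recursion hu 0
  rw [painleveITheta_of_neg hu (m := 0 - 1) (by norm_num), if_pos rfl, mul_zero, sub_zero] at h
  exact eq_one_div_of_mul_eq_one_right h

theorem painleveI_xi (u : R) (i : ℕ) :
    (painleveI u).xi i = HahnSeries.single (-(2 * (i : ℤ) + 2)) (oddDoubleFactorial i) := by
  have hcast : ∀ n : ℕ, (n : R⸨X⸩) = HahnSeries.single (0 : ℤ) (n : R) := fun n => by
    rw [← HahnSeries.C_apply, map_natCast]
  have hne : ((2 * i : ℕ) + 1 : R⸨X⸩) ≠ 0 := by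
    rw [← Nat.cast_succ, hcast]
    exact HahnSeries.single_ne_zero (Nat.cast_ne_zero.mpr (Nat.succ_ne_zero _))
  have hcoeff := coeff_inv_sq_C_sub_X
    (Units.mk0 (HahnSeries.single (1 : ℤ) (1 : R)) (HahnSeries.single_ne_zero one_ne_zero)) (2 * i)
  rw [Units.val_mk0] at hcoeff
  rw [OnePointCurve.xi, primitive, PowerSeries.coeff_mk, if_neg (by omega), Nat.add_sub_cancel,
    painleveI_omega02, hcoeff, Nat.cast_succ, mul_div_cancel_left₀ _ hne, HahnSeries.inv_single,
    inv_one, HahnSeries.single_pow, hcast, HahnSeries.single_mul_single]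
  simp [oddDoubleFactorial]

theorem painleveI_airy_A (hu : u ≠ 0) (i j k : ℕ) : (painleveI u).airy.A i j k =
    if i = 0 ∧ j = 0 ∧ k = 0 then 1 / (6 * u) else 0 := by
  simp only [OnePointCurve.airy, residue, coe_e, coe_de, HahnSeries.coeff_mul_single]
  rw [show (-1 - 2 * (k : ℤ) - 2 * j - (2 * i + 1)) = 2 * (-(i + j + k : ℤ)) - 2 by ring,
    ← painleveITheta]
  by_cases h : i = 0 ∧ j = 0 ∧ k = 0
  · obtain ⟨rfl, rfl, rfl⟩ := h
    simp [painleveITheta_zero hu, oddDoubleFactorial]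
  · rw [if_neg h, painleveITheta_of_neg hu (by omega)]
    ring

theorem painleveI_airy_B (u : R) (i j k : ℕ) : (painleveI u).airy.B i j k =
    painleveITheta u ((k : ℤ) + 1 - i - j) * (1 / oddDoubleFactorial i) *
      ((2 * (j : R) + 1) / oddDoubleFactorial j) * oddDoubleFactorial k := by
  simp only [OnePointCurve.airy, residue, coe_e, coe_de, painleveI_xi,
    HahnSeries.coeff_mul_single, painleveITheta]
  ring_nf

theorem painleveI_airy_C (u : R) (i j k : ℕ) : (painleveI u).airy.C i j k =
    painleveITheta u ((j : ℤ) + k + 2 - i) * (1 / oddDoubleFactorial i) *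
      oddDoubleFactorial j * oddDoubleFactorial k := by
  simp only [OnePointCurve.airy, residue, coe_e, painleveI_xi, HahnSeries.coeff_mul_single,
    painleveITheta]
  ring_nf

theorem painleveI_airy_D (hu : u ≠ 0) (i : ℕ) :
    (painleveI u).airy.D i * oddDoubleFactorial i = painleveITheta u (1 - i) / 8 := by
  have h0 : (painleveI u).thetaCoeff 0 = painleveITheta u 0 := rfl
  have h1 : (painleveI u).thetaCoeff 1 = painleveITheta u 1 := rfl
  have h2 : (painleveI u).phi 0 0 = 0 := rfl
  simp only [OnePointCurve.airy, h0, h1, h2, mul_zero, zero_add]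
  match i with
  | 0 => simp [oddDoubleFactorial]
  | 1 =>
    norm_num [oddDoubleFactorial, Nat.doubleFactorial]
    ring
  | i + 2 =>
    rw [if_neg (by omega), if_neg (by omega),
      painleveITheta_of_neg hu (by push_cast; omega)]
    simp

end PainleveICurve

section Lists

variable {α M : Type*} [AddCommMonoid M]

theorem sum_get_eraseIdx [DecidableEq α] (l : List α) (f : α → List α → M)
    (F : α → Multiset α → M) (h : ∀ k L, L.length + 1 = l.length → f k L = F k L) :
    ∑ m : Fin l.length, f (l.get m) (l.eraseIdx m) = eraseSum l F := by
  induction l generalizing f F with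
  | nil => simp
  | cons a l ih =>
    rw [← Multiset.cons_coe, eraseSum_cons]
    simp only [List.length_cons]
    rw [Fin.sum_univ_succ]
    congr 1
    · exact h _ _ rfl
    · refine ih (fun k L => f k (a :: L)) _ fun k L hL => ?_
      rw [h k (a :: L) (by simp [hL]), Multiset.cons_coe]

theorem coe_map_listSplits (l : List α) :
    (((listSplits l).map fun s => ((s.1 : Multiset α), (s.2 : Multiset α)) : List _) :
      Multiset (Multiset α × Multiset α)) = Multiset.antidiagonal l := by
  induction l with
  | nil => simp [listSplits]
  | cons a l ih =>
    rw [← Multiset.cons_coe, Multiset.antidiagonal_cons, ← ih, listSplits, List.map_append,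
      List.map_map, List.map_map, Multiset.map_coe, Multiset.map_coe, List.map_map, List.map_map,
      Multiset.coe_add, Multiset.coe_eq_coe]
    exact List.perm_append_comm

theorem sum_map_listSplits (l : List α) (f : List α → List α → M)
    (F : Multiset α → Multiset α → M)
    (h : ∀ I J, I.length + J.length = l.length → f I J = F I J) :
    ((listSplits l).map fun s => f s.1 s.2).sum = splitSum l F := by
  rw [splitSum, ← coe_map_listSplits, Multiset.map_coe, List.map_map, Multiset.sum_coe]
  exact congrArg _ (List.map_congr_left fun s hs => h _ _ (length_of_mem_listSplits hs))

end Lists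

namespace AiryTensors

variable {R : Type*} [Field R] (Q : AiryTensors R)

/-- The amplitude as a function of its first index and the multiset of the others. For a symmetric
tensor `A` the arbitrary order chosen for the latter is immaterial. -/
noncomputable def headAmplitude (g i : ℕ) (K : Multiset ℕ) : R := Q.amplitude g (i :: K.toList)

/-- The right-hand side of the recursion as a function of the first index and the multiset of the
others. -/
noncomputable def recursionTerm (g i : ℕ) (K : Multiset ℕ) : R :=
  eraseSum K (fun k L => ∑ᶠ μ : ℕ, Q.B i k μ * Q.headAmplitude g μ L) +
    1 / 2 * ∑ᶠ p : ℕ × ℕ, Q.C i p.1 p.2 * quadTerm Q.headAmplitude g p.1 p.2 K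

theorem headAmplitude_eq_zero_of_unstable (g i : ℕ) (K : Multiset ℕ) (h : 2 * g + K.card ≤ 1) :
    Q.headAmplitude g i K = 0 :=
  Q.amplitude_eq_zero_of_unstable _ _ (by rw [List.length_cons, Multiset.length_toList]; omega)

theorem amplitude_mul_amplitude_eq_headAmplitude {a b i j : ℕ} {I J : List ℕ} {N : ℕ}
    (hN : 2 * (a + b) + (I.length + J.length) = N)
    (ih : ∀ g' i' l', 2 * g' + List.length l' < N →
      Q.amplitude g' (i' :: l') = Q.headAmplitude g' i' l') :
    Q.amplitude a (i :: I) * Q.amplitude b (j :: J) =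
      Q.headAmplitude a i I * Q.headAmplitude b j J := by
  by_cases hI : 2 * a + I.length < N
  · by_cases hJ : 2 * b + J.length < N
    · rw [ih _ _ _ hI, ih _ _ _ hJ]
    · rw [amplitude_eq_zero_of_unstable Q a _ (by rw [List.length_cons]; omega),
        headAmplitude_eq_zero_of_unstable Q a _ _ (by rw [Multiset.coe_card]; omega),
        zero_mul, zero_mul]
  · rw [amplitude_eq_zero_of_unstable Q b _ (by rw [List.length_cons]; omega),
      headAmplitude_eq_zero_of_unstable Q b _ _ (by rw [Multiset.coe_card]; omega),
      mul_zero, mul_zero]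

theorem amplitude_eq_recursionTerm (g i : ℕ) (l : List ℕ) (h : 2 < 2 * g + (i :: l).length)
    (h03 : ¬(g = 0 ∧ l.length = 2)) (h11 : ¬(g = 1 ∧ l.length = 0))
    (ih : ∀ g' i' l', 2 * g' + List.length l' < 2 * g + l.length →
      Q.amplitude g' (i' :: l') = Q.headAmplitude g' i' l') :
    Q.amplitude g (i :: l) = Q.recursionTerm g i l := by
  rw [amplitude_rec Q g i l h h03 h11, recursionTerm]
  congr 1
  · refine sum_get_eraseIdx l (fun k L => ∑ᶠ μ : ℕ, Q.B i k μ * Q.amplitude g (μ :: L)) _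
      fun k L hL => finsum_congr fun μ => ?_
    rw [ih _ _ _ (by omega)]
  · refine congrArg _ (finsum_congr fun p => ?_)
    rw [quadTerm, loopTerm, productTerm]
    congr 2
    · by_cases hg : g = 0
      · simp [hg]
      · rw [if_neg hg, if_pos (by omega),
          ih _ _ _ (by rw [List.length_cons]; omega), Multiset.cons_coe]
    · refine Finset.sum_congr rfl fun q hq => ?_
      rw [Finset.HasAntidiagonal.mem_antidiagonal] at hq
      exact sum_map_listSplits l
        (fun I J => Q.amplitude q.1 (p.1 :: I) * Q.amplitude q.2 (p.2 :: J)) _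
        fun I J hIJ => Q.amplitude_mul_amplitude_eq_headAmplitude (by rw [hq, hIJ]) ih

section Symmetric

variable {Q} (hA : ∀ i j k, Q.A i j k = Q.A i k j)
include hA

theorem amplitude_zero_eq_of_perm (i : ℕ) {l l' : List ℕ} (h : l'.Perm l) (hl : l.length = 2) :
    Q.amplitude 0 (i :: l) = Q.amplitude 0 (i :: l') := by
  obtain ⟨j, k, rfl⟩ := List.length_eq_two.mp hl
  rcases List.perm_pair.mp h with rfl | rfl
  · rfl
  · simp only [amplitude, hA i j k]

theorem amplitude_eq_headAmplitude (g i : ℕ) (l : List ℕ) :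
    Q.amplitude g (i :: l) = Q.headAmplitude g i l := by
  induction hN : 2 * g + l.length using Nat.strong_induction_on generalizing g i l with
  | _ N ih =>
    have hperm : (l : Multiset ℕ).toList.Perm l := Multiset.coe_eq_coe.mp (Multiset.coe_toList _)
    by_cases hstable : 2 < 2 * g + (i :: l).length
    · by_cases h03 : g = 0 ∧ l.length = 2
      · obtain ⟨rfl, hl⟩ := h03
        exact amplitude_zero_eq_of_perm hA i hperm hl
      · by_cases h11 : g = 1 ∧ l.length = 0
        · obtain rfl := List.length_eq_zero_iff.mp h11.2
          simp [headAmplitude]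
        · have ih' : ∀ g' i' l', 2 * g' + List.length l' < 2 * g + l.length →
              Q.amplitude g' (i' :: l') = Q.headAmplitude g' i' l' :=
            fun g' i' l' hlt => ih _ (by omega) g' i' l' rfl
          rw [headAmplitude, amplitude_eq_recursionTerm Q g i l hstable h03 h11 ih',
            amplitude_eq_recursionTerm Q g i (l : Multiset ℕ).toList (by simpa using hstable)
              (by simpa using h03) (by simpa using h11) (by simpa using ih'),
            Multiset.coe_toList]
    · rw [amplitude_eq_zero_of_unstable Q g _ (by omega),
        headAmplitude_eq_zero_of_unstable Q g _ _
          (by rw [List.length_cons] at hstable; rw [Multiset.coe_card]; omega)]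

theorem headAmplitude_eq_recursionTerm (g i : ℕ) (K : Multiset ℕ) (h : 1 < 2 * g + K.card)
    (h03 : ¬(g = 0 ∧ K.card = 2)) (h11 : ¬(g = 1 ∧ K.card = 0)) :
    Q.headAmplitude g i K = Q.recursionTerm g i K := by
  conv_rhs => rw [← Multiset.coe_toList K]
  exact Q.amplitude_eq_recursionTerm g i K.toList
    (by rw [List.length_cons, Multiset.length_toList]; omega) (by simpa using h03)
    (by simpa using h11) fun g' i' l' _ => amplitude_eq_headAmplitude hA g' i' l'

end Symmetric

end AiryTensors

section NormalizedAmplitudes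

variable {R : Type*} [Field R]

/-- The amplitudes of the Painlevé I curve multiplied by `(2k+1)!!` for each index `k`; the first
index is separated from the multiset of the others. -/
noncomputable def normalizedAmplitude (u : R) (g i : ℕ) (K : Multiset ℕ) : R :=
  (painleveI u).airy.headAmplitude g i K *
    (oddDoubleFactorial i * (K.map oddDoubleFactorial).prod)

theorem quadTerm_normalizedAmplitude (u : R) (g μ ν : ℕ) (K : Multiset ℕ) :
    quadTerm (normalizedAmplitude u) g μ ν K =
      oddDoubleFactorial μ * oddDoubleFactorial ν * (K.map oddDoubleFactorial).prod *
        quadTerm (painleveI u).airy.headAmplitude g μ ν K := by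
  rw [quadTerm, quadTerm, loopTerm, loopTerm, productTerm, productTerm, mul_add, Finset.mul_sum]
  congr 1
  · split_ifs
    · simp
    · rw [normalizedAmplitude, Multiset.map_cons, Multiset.prod_cons]
      ring
  · refine Finset.sum_congr rfl fun q _ => ?_
    rw [← splitSum_mul_left]
    refine splitSum_congr fun I J hIJ => ?_
    rw [normalizedAmplitude, normalizedAmplitude, ← hIJ, Multiset.map_add, Multiset.prod_add]
    ring

theorem normalizedAmplitude_unstable (u : R) (g i : ℕ) (K : Multiset ℕ)
    (h : 2 * g + K.card ≤ 1) : normalizedAmplitude u g i K = 0 := by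
  rw [normalizedAmplitude, AiryTensors.headAmplitude_eq_zero_of_unstable _ _ _ _ h, zero_mul]

theorem quadTerm_eq_zero {G : ℕ → ℕ → Multiset ℕ → R} {g μ ν : ℕ} {K : Multiset ℕ}
    (hloop : g ≠ 0 → G (g - 1) μ (ν ::ₘ K) = 0)
    (hproduct : ∀ a b I J, a + b = g → I + J = K → G a μ I = 0 ∨ G b ν J = 0) :
    quadTerm G g μ ν K = 0 := by
  have hsum : productTerm G G g μ ν K = 0 := by
    refine Finset.sum_eq_zero fun q hq => (splitSum_congr fun I J hIJ => ?_).trans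
      (splitSum_const_zero K)
    exact mul_eq_zero.mpr
      (hproduct _ _ I J (Finset.HasAntidiagonal.mem_antidiagonal.mp hq) hIJ)
  rw [quadTerm, loopTerm, hsum, add_zero]
  split_ifs with hg
  · rfl
  · exact hloop hg

theorem quadTerm_eq_zero_of_unstable (u : R) (g μ ν : ℕ) (K : Multiset ℕ)
    (h : 2 * g + K.card ≤ 2) : quadTerm (normalizedAmplitude u) g μ ν K = 0 := by
  refine quadTerm_eq_zero (fun hg => ?_) fun a b I J hab hIJ => ?_
  · exact normalizedAmplitude_unstable u _ _ _ (by rw [Multiset.card_cons]; omega)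
  · have hcard : I.card + J.card = K.card := by rw [← hIJ, Multiset.card_add]
    by_cases hI : 2 * a + I.card ≤ 1
    · exact Or.inl (normalizedAmplitude_unstable u _ _ _ hI)
    · exact Or.inr (normalizedAmplitude_unstable u _ _ _ (by omega))

theorem quadTerm_eq_zero_of_lt {G : ℕ → ℕ → Multiset ℕ → R} {g μ ν : ℕ} {K : Multiset ℕ}
    (h : 3 * g + K.card < μ + ν + K.sum + 4)
    (hunstable : ∀ g' i' K', 2 * g' + Multiset.card K' ≤ 1 → G g' i' K' = 0)
    (ih : ∀ g' i' K', 2 * g' + Multiset.card K' < 2 * g + K.card →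
      3 * g' + K'.card < i' + K'.sum + 2 → G g' i' K' = 0) :
    quadTerm G g μ ν K = 0 := by
  refine quadTerm_eq_zero (fun hg => ih _ _ _ ?_ ?_) fun a b I J hab hIJ => ?_
  · rw [Multiset.card_cons]
    omega
  · rw [Multiset.card_cons, Multiset.sum_cons]
    omega
  · have hcard : I.card + J.card = K.card := by rw [← hIJ, Multiset.card_add]
    have hsum : I.sum + J.sum = K.sum := by rw [← hIJ, Multiset.sum_add]
    by_cases hIu : 2 * a + I.card ≤ 1
    · exact Or.inl (hunstable _ _ _ hIu)
    by_cases hJu : 2 * b + J.card ≤ 1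
    · exact Or.inr (hunstable _ _ _ hJu)
    by_cases hI : 3 * a + I.card < μ + I.sum + 2
    · exact Or.inl (ih _ _ _ (by omega) hI)
    · exact Or.inr (ih _ _ _ (by omega) (by omega))

variable [CharZero R] {u : R}

theorem oddDoubleFactorial_ne_zero (k : ℕ) : (oddDoubleFactorial k : R) ≠ 0 :=
  Nat.cast_ne_zero.mpr (Nat.doubleFactorial_pos _).ne'

theorem painleveI_airy_A_comm (hu : u ≠ 0) (i j k : ℕ) :
    (painleveI u).airy.A i j k = (painleveI u).airy.A i k j := by
  rw [painleveI_airy_A hu, painleveI_airy_A hu]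
  simp only [and_comm (a := j = 0)]

theorem normalizedAmplitude_three (hu : u ≠ 0) (i j k : ℕ) :
    normalizedAmplitude u 0 i {j, k} = if i = 0 ∧ j = 0 ∧ k = 0 then 1 / (6 * u) else 0 := by
  have h := AiryTensors.amplitude_eq_headAmplitude (painleveI_airy_A_comm hu) 0 i [j, k]
  rw [show (([j, k] : List ℕ) : Multiset ℕ) = {j, k} from rfl] at h
  rw [normalizedAmplitude, ← h, AiryTensors.amplitude, painleveI_airy_A hu]
  split_ifs with hz
  · obtain ⟨rfl, rfl, rfl⟩ := hz
    simp [oddDoubleFactorial]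
  · simp

theorem normalizedAmplitude_torus (hu : u ≠ 0) (i : ℕ) :
    normalizedAmplitude u 1 i 0 = painleveITheta u (1 - i) / 8 := by
  rw [← painleveI_airy_D hu, normalizedAmplitude, AiryTensors.headAmplitude, Multiset.toList_zero,
    AiryTensors.amplitude]
  simp [oddDoubleFactorial]

theorem normalizedAmplitude_rec (hu : u ≠ 0) (g i : ℕ) (K : Multiset ℕ)
    (h : 1 < 2 * g + K.card) (h03 : ¬(g = 0 ∧ K.card = 2)) (h11 : ¬(g = 1 ∧ K.card = 0)) :
    normalizedAmplitude u g i K = eraseSum K (fun k L => (2 * (k : R) + 1) *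
        ∑ᶠ μ : ℕ, painleveITheta u ((μ : ℤ) + 1 - (i + k : ℕ)) * normalizedAmplitude u g μ L) +
      1 / 2 * ∑ᶠ p : ℕ × ℕ, painleveITheta u ((p.1 : ℤ) + p.2 + 2 - i) *
        quadTerm (normalizedAmplitude u) g p.1 p.2 K := by
  have hi := oddDoubleFactorial_ne_zero (R := R) i
  rw [normalizedAmplitude,
    AiryTensors.headAmplitude_eq_recursionTerm (painleveI_airy_A_comm hu) g i K h h03 h11,
    AiryTensors.recursionTerm, mul_comm, mul_add, ← eraseSum_mul_left, mul_left_comm, mul_finsum]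
  congr 1
  · refine eraseSum_congr fun k L hL => ?_
    have hk := oddDoubleFactorial_ne_zero (R := R) k
    have hprod : (K.map oddDoubleFactorial).prod =
        (oddDoubleFactorial k * (L.map oddDoubleFactorial).prod : R) := by
      rw [← hL, Multiset.map_cons, Multiset.prod_cons]
    rw [mul_finsum, mul_finsum]
    refine finsum_congr fun μ => ?_
    rw [hprod, normalizedAmplitude, painleveI_airy_B,
      show ((μ : ℤ) + 1 - (i + k : ℕ)) = (μ : ℤ) + 1 - i - k by push_cast; ring]
    field_simp
  · refine congrArg _ (finsum_congr fun p => ?_)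
    rw [quadTerm_normalizedAmplitude, painleveI_airy_C]
    field_simp

theorem normalizedAmplitude_eq_zero_of_lt (hu : u ≠ 0) (g i : ℕ) (K : Multiset ℕ)
    (h : 3 * g + K.card < i + K.sum + 2) : normalizedAmplitude u g i K = 0 := by
  induction hN : 2 * g + K.card using Nat.strong_induction_on generalizing g i K with
  | _ N ih =>
    subst hN
    by_cases hunstable : 2 * g + K.card ≤ 1
    · exact normalizedAmplitude_unstable u g i K hunstable
    by_cases h03 : g = 0 ∧ K.card = 2
    · obtain ⟨rfl, hcard⟩ := h03
      obtain ⟨j, k, rfl⟩ := Multiset.card_eq_two.mp hcard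
      rw [normalizedAmplitude_three hu, if_neg]
      rintro ⟨rfl, rfl, rfl⟩
      simp at h
    by_cases h11 : g = 1 ∧ K.card = 0
    · obtain ⟨rfl, hcard⟩ := h11
      obtain rfl := Multiset.card_eq_zero.mp hcard
      rw [Multiset.card_zero, Multiset.sum_zero] at h
      rw [normalizedAmplitude_torus hu, painleveITheta_of_neg hu (by omega), zero_div]
    have hmerge : eraseSum K (fun k L => (2 * (k : R) + 1) * ∑ᶠ μ : ℕ,
        painleveITheta u ((μ : ℤ) + 1 - (i + k : ℕ)) * normalizedAmplitude u g μ L) = 0 := by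
      refine eraseSum_eq_zero fun k L hL => ?_
      subst hL
      rw [Multiset.card_cons] at h ih
      rw [Multiset.sum_cons] at h
      rw [finsum_eq_zero_of_forall_eq_zero fun μ => ?_, mul_zero]
      by_cases hμ : μ + 1 < i + k
      · rw [painleveITheta_of_neg hu (by omega), zero_mul]
      · rw [ih _ (by omega) g μ L (by omega) rfl, mul_zero]
    rw [normalizedAmplitude_rec hu g i K (by omega) h03 h11, hmerge, zero_add,
      finsum_eq_zero_of_forall_eq_zero fun p => ?_, mul_zero]
    by_cases hp : p.1 + p.2 + 2 < i
    · rw [painleveITheta_of_neg hu (by omega), zero_mul]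
    · rw [quadTerm_eq_zero_of_lt (by omega) (normalizedAmplitude_unstable u)
        fun g' i' K' hlt hd => ih _ hlt g' i' K' hd rfl, mul_zero]

theorem finsum_painleveITheta {ι : Type*} (hu : u ≠ 0) (e : ι → ℤ) (f : ι → R)
    (hf : f.support.Finite) :
    6 * u * ∑ᶠ a, painleveITheta u (e a) * f a - 2 * ∑ᶠ a, painleveITheta u (e a - 1) * f a =
      ∑ᶠ a, if e a = 0 then f a else 0 := by
  have hsupp (c : R) (θ : ι → R) : (Function.support fun a => c * (θ a * f a)).Finite :=
    hf.subset fun a ha hfa => ha (by simp [hfa])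
  rw [mul_finsum, mul_finsum, ← finsum_sub_distrib (hsupp _ _) (hsupp _ _)]
  refine finsum_congr fun a => ?_
  have hθ := painleveITheta_recursion hu (e a)
  split_ifs at hθ ⊢ <;> linear_combination f a * hθ

theorem finsum_painleveITheta_single (hu : u ≠ 0) (s : ℕ) (f : ℕ → R) (hf : f.support.Finite) :
    6 * u * ∑ᶠ μ : ℕ, painleveITheta u ((μ : ℤ) + 1 - s) * f μ -
      2 * ∑ᶠ μ : ℕ, painleveITheta u ((μ : ℤ) + 1 - (s + 1 : ℕ)) * f μ = shiftDown f s := by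
  have h := finsum_painleveITheta hu (fun μ : ℕ => (μ : ℤ) + 1 - s) f hf
  simp only [sub_sub _ (s : ℤ) 1, ← Nat.cast_succ (R := ℤ) s] at h
  rw [h]
  rcases s with _ | s
  · exact finsum_eq_zero_of_forall_eq_zero fun μ => if_neg (by omega)
  · rw [finsum_eq_single _ s fun μ hμ => if_neg (by omega), if_pos (by omega), shiftDown_succ]

theorem finsum_painleveITheta_pair (hu : u ≠ 0) (i : ℕ) (f : ℕ → ℕ → R)
    (hf : (Function.support fun p : ℕ × ℕ => f p.1 p.2).Finite) :
    6 * u * ∑ᶠ p : ℕ × ℕ, painleveITheta u ((p.1 : ℤ) + p.2 + 2 - i) * f p.1 p.2 -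
      2 * ∑ᶠ p : ℕ × ℕ, painleveITheta u ((p.1 : ℤ) + p.2 + 2 - (i + 1 : ℕ)) * f p.1 p.2 =
      pairSum f i := by
  have h := finsum_painleveITheta hu (fun p : ℕ × ℕ => (p.1 : ℤ) + p.2 + 2 - i)
    (fun p : ℕ × ℕ => f p.1 p.2) hf
  simp only [sub_sub _ (i : ℤ) 1, ← Nat.cast_succ (R := ℤ) i] at h
  rw [h]
  have hz (hi : i < 2) : ∑ᶠ p : ℕ × ℕ, (if (p.1 : ℤ) + p.2 + 2 - i = 0 then f p.1 p.2 else 0) = 0 :=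
    finsum_eq_zero_of_forall_eq_zero fun p => if_neg (by omega)
  match i with
  | 0 => exact hz (by norm_num)
  | 1 => exact hz (by norm_num)
  | i + 2 =>
    rw [pairSum_add_two,
      finsum_eq_sum_of_support_subset (s := Finset.HasAntidiagonal.antidiagonal i)]
    · refine Finset.sum_congr rfl fun p hp => if_pos ?_
      rw [Finset.HasAntidiagonal.mem_antidiagonal] at hp
      omega
    · intro p hp
      rw [Finset.mem_coe, Finset.HasAntidiagonal.mem_antidiagonal]
      by_contra hne
      exact hp (if_neg (by omega))

theorem finite_support_normalizedAmplitude (hu : u ≠ 0) (g : ℕ) (K : Multiset ℕ) :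
    (Function.support fun μ => normalizedAmplitude u g μ K).Finite := by
  refine (Set.finite_Iio (3 * g + K.card)).subset fun μ hμ => ?_
  by_contra hle
  rw [Set.mem_Iio] at hle
  exact hμ (normalizedAmplitude_eq_zero_of_lt hu _ _ _ (by omega))

theorem finite_support_quadTerm_normalizedAmplitude (hu : u ≠ 0) (g : ℕ) (K : Multiset ℕ) :
    (Function.support fun p : ℕ × ℕ =>
      quadTerm (normalizedAmplitude u) g p.1 p.2 K).Finite := by
  refine (Set.finite_Iic ((3 * g + K.card, 3 * g + K.card) : ℕ × ℕ)).subset fun p hp => ?_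
  by_contra hle
  rw [Set.mem_Iic, Prod.le_def] at hle
  exact hp (quadTerm_eq_zero_of_lt (by omega) (normalizedAmplitude_unstable u)
    fun _ _ _ _ => normalizedAmplitude_eq_zero_of_lt hu _ _ _)

theorem normalizedAmplitude_constraint_of_stable (hu : u ≠ 0) (g i : ℕ) (K : Multiset ℕ)
    (h : 1 < 2 * g + K.card) (h03 : ¬(g = 0 ∧ K.card = 2)) (h11 : ¬(g = 1 ∧ K.card = 0)) :
    6 * u * normalizedAmplitude u g i K = 2 * normalizedAmplitude u g (i + 1) K +
      mergeSum i K (normalizedAmplitude u g) + 1 / 2 * cutTerm (normalizedAmplitude u) g i K := by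
  have hcut := finsum_painleveITheta_pair hu i (fun μ ν => quadTerm (normalizedAmplitude u) g μ ν K)
    (finite_support_quadTerm_normalizedAmplitude hu g K)
  have hmerge : 6 * u * eraseSum K (fun k L => (2 * (k : R) + 1) * ∑ᶠ μ : ℕ,
        painleveITheta u ((μ : ℤ) + 1 - (i + k : ℕ)) * normalizedAmplitude u g μ L) =
      2 * eraseSum K (fun k L => (2 * (k : R) + 1) * ∑ᶠ μ : ℕ,
        painleveITheta u ((μ : ℤ) + 1 - (i + 1 + k : ℕ)) * normalizedAmplitude u g μ L) +
      mergeSum i K (normalizedAmplitude u g) := by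
    rw [mergeSum, ← eraseSum_mul_left, ← eraseSum_mul_left, ← eraseSum_add]
    refine eraseSum_congr fun k L _ => ?_
    have hθ := finsum_painleveITheta_single hu (i + k) _
      (finite_support_normalizedAmplitude hu g L)
    rw [add_right_comm] at hθ
    linear_combination (2 * (k : R) + 1) * hθ
  rw [normalizedAmplitude_rec hu g i K h h03 h11,
    normalizedAmplitude_rec hu g (i + 1) K h h03 h11, cutTerm]
  linear_combination hmerge + 1 / 2 * hcut

theorem normalizedAmplitude_constraint_three (hu : u ≠ 0) (i j k : ℕ) :
    6 * u * normalizedAmplitude u 0 i {j, k} =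
      2 * normalizedAmplitude u 0 (i + 1) {j, k} + seedTerm 0 i {j, k} := by
  have hpair : ({j, k} : Multiset ℕ) = {0, 0} ↔ j = 0 ∧ k = 0 := by
    rw [← Multiset.singleton_inj (a := k)]
    exact cons_eq_pair_self_iff
  simp only [normalizedAmplitude_three hu, seedTerm, hpair]
  simp only [true_and, Nat.succ_ne_zero, false_and, if_false, zero_ne_one, mul_zero, zero_add,
    add_zero]
  split_ifs
  · field_simp
  · ring

theorem normalizedAmplitude_constraint_torus (hu : u ≠ 0) (i : ℕ) :
    6 * u * normalizedAmplitude u 1 i 0 =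
      2 * normalizedAmplitude u 1 (i + 1) 0 + seedTerm 1 i 0 := by
  have hθ := painleveITheta_recursion hu (1 - i)
  rw [sub_sub, ← Nat.cast_succ] at hθ
  have hseed : (seedTerm 1 i 0 : R) = 1 / 8 * if (1 - (i : ℤ)) = 0 then 1 else 0 := by
    by_cases hi : i = 1
    · simp [seedTerm, hi]
    · rw [if_neg (by omega), seedTerm, if_neg (by omega), if_neg (by tauto)]
      ring
  rw [normalizedAmplitude_torus hu, normalizedAmplitude_torus hu, hseed]
  linear_combination 1 / 8 * hθ

theorem isVirasoroSolution_normalizedAmplitude (hu : u ≠ 0) :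
    IsVirasoroSolution u (normalizedAmplitude u) where
  eq_zero_of_lt := normalizedAmplitude_eq_zero_of_lt hu
  constraint g i K := by
    by_cases hstable : 1 < 2 * g + K.card ∧ ¬(g = 0 ∧ K.card = 2) ∧ ¬(g = 1 ∧ K.card = 0)
    · obtain ⟨h, h03, h11⟩ := hstable
      have hseed : (seedTerm g i K : R) = 0 := by
        rw [seedTerm, if_neg, if_neg, add_zero]
        · rintro ⟨rfl, -, rfl⟩
          exact h11 ⟨rfl, rfl⟩
        · rintro ⟨rfl, -, rfl⟩
          exact h03 ⟨rfl, rfl⟩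
      rw [normalizedAmplitude_constraint_of_stable hu g i K h h03 h11, hseed, add_zero]
    have hle : 2 * g + K.card ≤ 2 := by omega
    have hmerge : mergeSum i K (normalizedAmplitude u g) = 0 := by
      refine mergeSum_eq_zero fun m k L _ hL => normalizedAmplitude_unstable u g m L ?_
      rw [← hL, Multiset.card_cons] at hle
      omega
    have hcut : cutTerm (normalizedAmplitude u) g i K = 0 := by
      simp only [cutTerm, quadTerm_eq_zero_of_unstable u g _ _ K hle, pairSum_const_zero]
    rw [hmerge, hcut, mul_zero, add_zero, add_zero]
    by_cases h03 : g = 0 ∧ K.card = 2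
    · obtain ⟨rfl, hcard⟩ := h03
      obtain ⟨j, k, rfl⟩ := Multiset.card_eq_two.mp hcard
      exact normalizedAmplitude_constraint_three hu i j k
    by_cases h11 : g = 1 ∧ K.card = 0
    · obtain ⟨rfl, hcard⟩ := h11
      obtain rfl := Multiset.card_eq_zero.mp hcard
      exact normalizedAmplitude_constraint_torus hu i
    have hunstable : 2 * g + K.card ≤ 1 := by omega
    have hseed : (seedTerm g i K : R) = 0 := by
      rw [seedTerm, if_neg, if_neg (by omega), add_zero]
      rintro ⟨rfl, -, rfl⟩
      simp at hunstable
    rw [normalizedAmplitude_unstable u g i K hunstable,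
      normalizedAmplitude_unstable u g (i + 1) K hunstable, hseed]
    ring

end NormalizedAmplitudes

section Growth

theorem choose_mul_pow_mul_pow_le_one {x : ℝ} (hx : 0 ≤ x) (hx1 : x ≤ 1) (m j : ℕ) :
    x ^ j * (1 - x) ^ m * ((m + j).choose j : ℝ) ≤ 1 := by
  have hbinomial := add_pow x (1 - x) (m + j)
  rw [add_sub_cancel, one_pow] at hbinomial
  have hterm := Finset.single_le_sum (f := fun k => x ^ k * (1 - x) ^ (m + j - k) *
    ((m + j).choose k : ℝ)) (s := Finset.range (m + j + 1)) (a := j)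
    (fun k _ => mul_nonneg (mul_nonneg (pow_nonneg hx _) (pow_nonneg (by linarith) _))
      (Nat.cast_nonneg _)) (by simp)
  simpa using hterm.trans hbinomial.ge

theorem pow_mul_factorial_div_le {x : ℝ} (hx : 0 ≤ x) (hx1 : x ≤ 1) (m j : ℕ) :
    x ^ j * ((m + j)! / j ! : ℝ) * (1 - x) ^ m ≤ m ! := by
  have hratio : ((m + j)! / j ! : ℝ) = (m + j).choose j * m ! := by
    rw [Nat.add_comm m j, Nat.cast_add_choose]
    field_simp
  calc x ^ j * ((m + j)! / j ! : ℝ) * (1 - x) ^ m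
      = x ^ j * (1 - x) ^ m * ((m + j).choose j : ℝ) * m ! := by rw [hratio]; ring
    _ ≤ 1 * m ! := by gcongr; exact choose_mul_pow_mul_pow_le_one hx hx1 m j
    _ = m ! := one_mul _

theorem ampBound_le {t : ℝ} (ht : 0 ≤ t) (ht1 : 6 / 5 * t < 1) (h n j : ℕ) :
    ampBound t h n j ≤
      (1 / 4) ^ h * (3 * t / (1 - 6 / 5 * t)) ^ (2 * h + n) * ((2 * h + n)! : ℝ) := by
  have : 0 < 1 - 6 / 5 * t := by linarith
  have hbinomial :=
    pow_mul_factorial_div_le (by positivity : 0 ≤ 6 / 5 * t) ht1.le (2 * h + n) j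
  rw [div_pow _ (1 - 6 / 5 * t), mul_div_assoc', div_mul_eq_mul_div, le_div_iff₀ (by positivity)]
  calc ampBound t h n j * (1 - 6 / 5 * t) ^ (2 * h + n)
      = (9 / 4) ^ h * t ^ (2 * h + n) * 3 ^ n * ((6 / 5 * t) ^ j *
        ((2 * h + n + j)! / j ! : ℝ) * (1 - 6 / 5 * t) ^ (2 * h + n)) := by
        rw [ampBound, mul_pow]
        ring
    _ ≤ (9 / 4) ^ h * t ^ (2 * h + n) * 3 ^ n * (2 * h + n)! := by gcongr
    _ = (1 / 4) ^ h * (3 * t) ^ (2 * h + n) * (2 * h + n)! := by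
        rw [show (9 / 4 : ℝ) = 1 / 4 * 3 ^ 2 by norm_num, mul_pow, mul_pow, ← pow_mul, pow_add 3]
        ring

theorem exists_cube_mul_pow_le {y : ℝ} (hy : 0 < y) (hy1 : y < 1) :
    ∃ C : ℝ, ∀ h : ℕ, ((h : ℝ) + 1) ^ 3 * y ^ h ≤ C := by
  obtain ⟨B, hB⟩ := (tendsto_pow_const_mul_const_pow_of_abs_lt_one 3
    (r := y) (by rwa [abs_of_pos hy])).bddAbove_range
  refine ⟨B / y, fun h => ?_⟩
  have hsucc := hB ⟨h + 1, rfl⟩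
  rw [le_div_iff₀ hy, mul_assoc, ← pow_succ]
  exact_mod_cast hsucc

theorem twentySeven_fourths_pow_mul_factorial_le (h : ℕ) :
    (27 / 4 : ℝ) ^ h * ((2 * h)! * h !) ≤ ((h : ℝ) + 1) ^ 2 * (3 * h)! := by
  induction h with
  | zero => simp
  | succ h ih =>
    rw [show 2 * (h + 1) = 2 * h + 1 + 1 by ring, show 3 * (h + 1) = 3 * h + 1 + 1 + 1 by ring]
    simp only [Nat.factorial_succ]
    push_cast
    have hpolynomial : 27 / 4 * (2 * (h : ℝ) + 2) * (2 * h + 1) * (h + 1) * ((h : ℝ) + 1) ^ 2 ≤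
        ((h : ℝ) + 1 + 1) ^ 2 * ((3 * h + 1 + 1 + 1) * ((3 * h + 1 + 1) * (3 * h + 1))) := by
      rw [← sub_nonneg]
      ring_nf
      positivity
    calc (27 / 4 : ℝ) ^ (h + 1) *
          ((2 * h + 1 + 1) * ((2 * h + 1) * (2 * h)!) * ((h + 1) * h !))
        = 27 / 4 * (2 * h + 2) * (2 * h + 1) * (h + 1) *
          ((27 / 4 : ℝ) ^ h * ((2 * h)! * h !)) := by ring
      _ ≤ 27 / 4 * (2 * h + 2) * (2 * h + 1) * (h + 1) * (((h : ℝ) + 1) ^ 2 * (3 * h)!) := by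
          gcongr
      _ = 27 / 4 * (2 * h + 2) * (2 * h + 1) * (h + 1) * ((h : ℝ) + 1) ^ 2 * (3 * h)! := by ring
      _ ≤ ((h : ℝ) + 1 + 1) ^ 2 * ((3 * h + 1 + 1 + 1) * ((3 * h + 1 + 1) * (3 * h + 1))) *
          (3 * h)! := by gcongr
      _ = _ := by ring

theorem factorial_mul_factorial_le {a b : ℕ} (hab : a ≤ b) (n : ℕ) :
    (a + n)! * b ! ≤ (b + n)! * a ! := by
  rw [← Nat.factorial_mul_ascFactorial, ← Nat.factorial_mul_ascFactorial, mul_right_comm,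
    mul_right_comm (b !), mul_comm (a !)]
  gcongr

theorem factorial_le_cube_mul_factorial_div (h n : ℕ) :
    (27 / 4 : ℝ) ^ h * (2 * h + n)! ≤ ((h : ℝ) + 1) ^ 3 * ((3 * h + n)! / (h + 1)! : ℝ) := by
  have hratio : ((2 * h + n)! : ℝ) * (3 * h)! ≤ (3 * h + n)! * (2 * h)! := by
    exact_mod_cast factorial_mul_factorial_le (by omega : 2 * h ≤ 3 * h) n
  have hcentral := twentySeven_fourths_pow_mul_factorial_le h
  rw [← mul_div_assoc, le_div_iff₀ (by positivity), Nat.factorial_succ]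
  refine le_of_mul_le_mul_right ?_ (by positivity : (0 : ℝ) < (3 * h)!)
  push_cast
  calc (27 / 4 : ℝ) ^ h * (2 * h + n)! * ((h + 1) * h !) * (3 * h)!
      = (27 / 4 : ℝ) ^ h * ((h + 1) * h !) * ((2 * h + n)! * (3 * h)!) := by ring
    _ ≤ (27 / 4 : ℝ) ^ h * ((h + 1) * h !) * ((3 * h + n)! * (2 * h)!) := by gcongr
    _ = (h + 1) * (3 * h + n)! * ((27 / 4 : ℝ) ^ h * ((2 * h)! * h !)) := by ring
    _ ≤ (h + 1) * (3 * h + n)! * (((h : ℝ) + 1) ^ 2 * (3 * h)!) := by gcongr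
    _ = _ := by ring

theorem growthP_pos {u : ℝ} (hu : 0 < u) : 0 < growthP u := by
  unfold growthP
  split_ifs with h
  · positivity
  · exact div_pos (by norm_num) (by linarith)

theorem growthP_of_two_fifths_le {u : ℝ} (hu : 2 / 5 ≤ u) :
    growthP u = 3 * (1 / (6 * u)) / (1 - 6 / 5 * (1 / (6 * u))) := by
  have hu0 : 0 < u := by linarith
  have hden : 10 * u - 2 ≠ 0 := by linarith
  have hcancel : 1 - 6 / 5 * (1 / (6 * u)) = (10 * u - 2) / (10 * u) := by
    field_simp
    ring
  rw [growthP, if_neg (by linarith), hcancel]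
  field_simp
  norm_num

/-- The growth `(2u/27)^g P(u)^m m! / g!` claimed for the amplitudes with `m = 3g - 3 + n`. -/
noncomputable def growthBound (u : ℝ) (g m : ℕ) : ℝ :=
  (2 * u / 27) ^ g * growthP u ^ m * (m ! / g ! : ℝ)

theorem growthBound_nonneg {u : ℝ} (hu : 0 < u) (g m : ℕ) : 0 ≤ growthBound u g m := by
  have := growthP_pos hu
  unfold growthBound
  positivity

theorem growthBound_succ (u : ℝ) (g m : ℕ) :
    growthBound u g (m + 1) = (m + 1) * growthP u * growthBound u g m := by
  rw [growthBound, growthBound, Nat.factorial_succ]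
  push_cast
  ring

/-- `S` is a constant with which the majorants of the amplitudes grow as claimed. The ranges of `j`
are those in which `j` is a difference `3g - 3 + n - (k₁ + ⋯ + kₙ)`. -/
structure IsGrowthConstant (u S : ℝ) : Prop where
  pos : 0 < S
  ampBound_le : ∀ h n j : ℕ, j ≤ 3 * h + n →
    ampBound (1 / (6 * u)) h n j ≤ S * growthBound u (h + 1) (3 * h + n)
  genus_zero_le : ∀ c j : ℕ, j ≤ c →
    1 / (6 * u) * ampBound (1 / (6 * u)) 0 c j ≤ S * growthBound u 0 c

theorem ampBound_le_cube_mul_growthBound {u : ℝ} (hu : 2 / 5 ≤ u) (h n j : ℕ) :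
    ampBound (1 / (6 * u)) h n j ≤ ((h : ℝ) + 1) ^ 3 * (1 - 6 / 5 * (1 / (6 * u))) ^ h *
      (27 / (2 * u) * growthBound u (h + 1) (3 * h + n)) := by
  have hu0 : 0 < u := by linarith
  have ht : 6 / 5 * (1 / (6 * u)) < 1 := by
    rw [← mul_div_assoc, div_lt_one (by positivity)]
    linarith
  have hP := growthP_pos hu0
  have hP_eq := growthP_of_two_fifths_le hu
  have hbound := ampBound_le (by positivity) ht h n j
  rw [← hP_eq] at hbound
  set y := 1 - 6 / 5 * (1 / (6 * u)) with hy
  have hy0 : 0 < y := by linarith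
  have hone : 2 * u * y * growthP u = 1 := by
    rw [hP_eq]
    field_simp
    norm_num
  calc ampBound (1 / (6 * u)) h n j
      ≤ (1 / 4) ^ h * growthP u ^ (2 * h + n) * (2 * h + n)! * (2 * u * y * growthP u) ^ h := by
        rwa [hone, one_pow, mul_one]
    _ = (2 * u / 27 * y) ^ h * growthP u ^ (3 * h + n) * ((27 / 4) ^ h * (2 * h + n)!) := by
        rw [show (1 / 4 : ℝ) = 1 / 27 * (27 / 4) by norm_num,
          show 3 * h + n = 2 * h + n + h by ring, pow_add _ (2 * h + n) h]
        simp only [mul_pow, div_pow]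
        ring
    _ ≤ (2 * u / 27 * y) ^ h * growthP u ^ (3 * h + n) *
        (((h : ℝ) + 1) ^ 3 * ((3 * h + n)! / (h + 1)! : ℝ)) := by
        gcongr _ * ?_
        exact factorial_le_cube_mul_factorial_div h n
    _ = _ := by
        rw [growthBound, mul_pow, pow_succ (2 * u / 27)]
        field_simp

theorem exists_isGrowthConstant_of_two_fifths_le {u : ℝ} (hu : 2 / 5 ≤ u) :
    ∃ S, IsGrowthConstant u S := by
  have hu0 : 0 < u := by linarith
  have ht0 : 0 < 1 / (6 * u) := by positivity
  have ht : 6 / 5 * (1 / (6 * u)) < 1 := by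
    rw [← mul_div_assoc, div_lt_one (by positivity)]
    linarith
  obtain ⟨C, hC⟩ := exists_cube_mul_pow_le (y := 1 - 6 / 5 * (1 / (6 * u)))
    (by linarith) (by linarith)
  have hC1 : 1 ≤ C := by simpa using hC 0
  refine ⟨C * (27 / (2 * u)), by positivity, fun h n j _ => ?_, fun c j _ => ?_⟩
  · have hG := growthBound_nonneg hu0 (h + 1) (3 * h + n)
    rw [mul_assoc]
    exact (ampBound_le_cube_mul_growthBound hu h n j).trans (by gcongr; exact hC h)
  · have hbound : ampBound (1 / (6 * u)) 0 c j ≤ growthBound u 0 c := by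
      simpa [growthBound, growthP_of_two_fifths_le hu] using ampBound_le ht0.le ht 0 c j
    have hconst : 1 / (6 * u) ≤ C * (27 / (2 * u)) := by
      rw [mul_div_assoc', div_le_div_iff₀ (by positivity) (by positivity)]
      nlinarith
    exact mul_le_mul hconst hbound (ampBound_nonneg ht0.le 0 c j) (by positivity)

theorem ampBound_mul_left (s t : ℝ) (h n j : ℕ) :
    ampBound (s * t) h n j = s ^ (2 * h + n + j) * ampBound t h n j := by
  rw [ampBound, ampBound, mul_pow]
  ring

theorem growthP_div {s : ℝ} (hs : 1 ≤ s) : growthP (2 / 5 / s) = s ^ 2 * growthP (2 / 5) := by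
  have hs0 : 0 < s := by linarith
  have hle : 2 / 5 / s ≤ 2 / 5 := div_le_self (by norm_num) hs
  rw [growthP, growthP, if_neg (lt_irrefl _)]
  split_ifs with h
  · field_simp
    norm_num
  · obtain rfl : s = 1 := by
      have : 2 / 5 / s = 2 / 5 := by linarith
      field_simp at this
      exact this.symm
    norm_num

theorem growthBound_div {s : ℝ} (hs : 1 ≤ s) (g m : ℕ) :
    growthBound (2 / 5 / s) g m * s ^ g = s ^ (2 * m) * growthBound (2 / 5) g m := by
  have : 0 < s := by linarith
  rw [growthBound, growthBound, growthP_div hs, mul_pow, pow_mul s 2 m,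
    show 2 * (2 / 5 / s) / 27 = 2 * (2 / 5) / 27 / s by field_simp, div_pow _ s]
  field_simp

/-- The majorants scale like `s ^ (2h + n + j)`, which is largest at the maximal `j`; this is why
`P(u)` is proportional to `u⁻²` for small `u`. -/
theorem IsGrowthConstant.div {S s : ℝ} (hS : IsGrowthConstant (2 / 5) S) (hs : 1 ≤ s) :
    IsGrowthConstant (2 / 5 / s) (s * S) := by
  have hs0 : 0 < s := by linarith
  have ht : 1 / (6 * (2 / 5 / s)) = s * (1 / (6 * (2 / 5))) := by field_simp
  have hnonneg := ampBound_nonneg (by norm_num : (0 : ℝ) ≤ 1 / (6 * (2 / 5)))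
  refine ⟨mul_pos hs0 hS.pos, fun h n j hj => ?_, fun c j hj => ?_⟩
  · refine le_of_mul_le_mul_right ?_ (pow_pos hs0 (h + 1))
    have hA := hnonneg h n j
    rw [ht, ampBound_mul_left, mul_assoc (s * S), growthBound_div hs]
    calc s ^ (2 * h + n + j) * ampBound (1 / (6 * (2 / 5))) h n j * s ^ (h + 1)
        = s ^ (2 * h + n + j + (h + 1)) * ampBound (1 / (6 * (2 / 5))) h n j := by
          rw [pow_add _ _ (h + 1)]
          ring
      _ ≤ s ^ (2 * (3 * h + n) + 1) * ampBound (1 / (6 * (2 / 5))) h n j := by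
          gcongr ?_ * _
          exact pow_le_pow_right₀ hs (by omega)
      _ ≤ s ^ (2 * (3 * h + n) + 1) * (S * growthBound (2 / 5) (h + 1) (3 * h + n)) := by
          gcongr _ * ?_
          exact hS.ampBound_le h n j hj
      _ = _ := by ring
  · have hA := hnonneg 0 c j
    have hG := growthBound_div hs 0 c
    rw [pow_zero, mul_one] at hG
    rw [ht, ampBound_mul_left, hG]
    calc s * (1 / (6 * (2 / 5))) * (s ^ (2 * 0 + c + j) * ampBound (1 / (6 * (2 / 5))) 0 c j)
        = s ^ (c + j + 1) * (1 / (6 * (2 / 5)) * ampBound (1 / (6 * (2 / 5))) 0 c j) := by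
          ring
      _ ≤ s ^ (2 * c + 1) * (1 / (6 * (2 / 5)) * ampBound (1 / (6 * (2 / 5))) 0 c j) := by
          gcongr ?_ * _
          exact pow_le_pow_right₀ hs (by omega)
      _ ≤ s ^ (2 * c + 1) * (S * growthBound (2 / 5) 0 c) := by
          gcongr _ * ?_
          exact hS.genus_zero_le c j hj
      _ = _ := by ring

theorem exists_isGrowthConstant {u : ℝ} (hu : 0 < u) : ∃ S, IsGrowthConstant u S := by
  rcases le_total (2 / 5) u with hle | hle
  · exact exists_isGrowthConstant_of_two_fifths_le hle
  · obtain ⟨S, hS⟩ := exists_isGrowthConstant_of_two_fifths_le (le_refl (2 / 5 : ℝ))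
    have hscaled := hS.div ((one_le_div hu).mpr hle)
    rw [div_div_cancel₀ (by norm_num)] at hscaled
    exact ⟨_, hscaled⟩

end Growth

section FreeEnergy

variable {R : Type*} [Field R]

theorem primitive_monomial (n : ℕ) (c : R) :
    primitive (PowerSeries.monomial n c) = PowerSeries.monomial (n + 1) (c / (n + 1 : ℕ)) := by
  ext m
  rw [primitive, PowerSeries.coeff_mk, PowerSeries.coeff_monomial, PowerSeries.coeff_monomial]
  rcases m with _ | m
  · rw [if_pos rfl, if_neg (Nat.succ_ne_zero n).symm]
  · by_cases h : m = n <;> simp [h]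

theorem primitive_sub (f g : R⟦X⟧) : primitive (f - g) = primitive f - primitive g := by
  ext m
  simp only [primitive, PowerSeries.coeff_mk, map_sub]
  split_ifs
  · rw [sub_zero]
  · rw [sub_div]

theorem painleveI_y_mul_derivative_x (u : R) :
    (painleveI u).y * PowerSeries.derivative R (painleveI u).x =
      PowerSeries.monomial 4 2 - PowerSeries.monomial 2 (6 * u) := by
  rw [derivative_painleveI_x, painleveI, PowerSeries.monomial_eq_C_mul_X_pow,
    PowerSeries.monomial_eq_C_mul_X_pow]
  simp only [map_mul, map_ofNat]
  ring

theorem amplitude_singleton_mul_oddDoubleFactorial (u : R) (g i : ℕ) :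
    (painleveI u).airy.amplitude g [i] * oddDoubleFactorial i = normalizedAmplitude u g i 0 := by
  rw [normalizedAmplitude, AiryTensors.headAmplitude, Multiset.toList_zero, Multiset.map_zero,
    Multiset.prod_zero, mul_one]

variable [CharZero R] {u : R}

theorem primitive_painleveI_y_mul_derivative_x (u : R) :
    primitive ((painleveI u).y * PowerSeries.derivative R (painleveI u).x) =
      PowerSeries.monomial 5 (2 / 5) - PowerSeries.monomial 3 (2 * u) := by
  rw [painleveI_y_mul_derivative_x, primitive_sub, primitive_monomial, primitive_monomial]
  norm_num
  congr 2
  ring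

theorem painleveI_omega1_eq_sum (hu : u ≠ 0) (g : ℕ) :
    (painleveI u).omega1 g = ∑ i ∈ Finset.range (3 * g),
      HahnSeries.single (-(2 * (i : ℤ) + 2)) (normalizedAmplitude u g i 0) := by
  have hterm : ∀ i, (painleveI u).airy.amplitude g [i] • (painleveI u).xi i =
      HahnSeries.single (-(2 * (i : ℤ) + 2)) (normalizedAmplitude u g i 0) := fun i => by
    rw [painleveI_xi, ← amplitude_singleton_mul_oddDoubleFactorial]
    exact (HahnSeries.single.linearMap _ |>.map_smul _ _).symm
  rw [OnePointCurve.omega1, finsum_congr hterm]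
  refine finsum_eq_sum_of_support_subset _ fun i hi => ?_
  rw [Finset.coe_range, Set.mem_Iio]
  by_contra hge
  refine hi ?_
  beta_reduce
  rw [normalizedAmplitude_eq_zero_of_lt hu g i 0
    (by rw [Multiset.card_zero, Multiset.sum_zero]; omega), HahnSeries.single_eq_zero]

theorem coeff_painleveI_omega1 (hu : u ≠ 0) (g m : ℕ) :
    ((painleveI u).omega1 g).coeff (-(2 * (m : ℤ) + 2)) = normalizedAmplitude u g m 0 := by
  have hcoeff : ∀ i : ℕ,
      (HahnSeries.single (-(2 * (i : ℤ) + 2)) (normalizedAmplitude u g i 0)).coeff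
        (-(2 * (m : ℤ) + 2)) = if m = i then normalizedAmplitude u g i 0 else 0 := fun i => by
    rw [HahnSeries.coeff_single]
    congr 1
    simp only [neg_inj, add_left_inj, mul_eq_mul_left_iff, Nat.cast_inj, OfNat.ofNat_ne_zero,
      or_false]
  rw [painleveI_omega1_eq_sum hu, HahnSeries.coeff_sum, Finset.sum_congr rfl fun i _ => hcoeff i,
    Finset.sum_ite_eq, ite_eq_left_iff, Finset.mem_range]
  intro hm
  exact (normalizedAmplitude_eq_zero_of_lt hu g m 0
    (by rw [Multiset.card_zero, Multiset.sum_zero]; omega)).symm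

theorem residue_primitive_mul_omega1 (hu : u ≠ 0) (g : ℕ) :
    residue ((primitive ((painleveI u).y * PowerSeries.derivative R (painleveI u).x) : R⸨X⸩) *
      (painleveI u).omega1 g) =
      2 / 5 * normalizedAmplitude u g 2 0 - 2 * u * normalizedAmplitude u g 1 0 := by
  rw [primitive_painleveI_y_mul_derivative_x, map_sub, ofPowerSeries_monomial,
    ofPowerSeries_monomial, sub_mul, residue, HahnSeries.coeff_sub, HahnSeries.coeff_single_mul,
    HahnSeries.coeff_single_mul, ← coeff_painleveI_omega1 hu, ← coeff_painleveI_omega1 hu]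
  norm_num

theorem painleveI_freeEnergy_succ (hu : u ≠ 0) {h : ℕ} (hh : h ≠ 0) :
    (painleveI u).freeEnergy (h + 1) = 2 * u / (5 * h) * normalizedAmplitude u (h + 1) 1 0 := by
  have hconstraint := (isVirasoroSolution_normalizedAmplitude hu).constraint (h + 1) 1 0
  have htwo : normalizedAmplitude u (h + 1) 2 0 = 3 * u * normalizedAmplitude u (h + 1) 1 0 := by
    rw [cutTerm, pairSum_one, mergeSum_empty, seedTerm_one, if_neg (by omega)] at hconstraint
    linear_combination (-1 / 2) * hconstraint
  have hh' : (h : R) ≠ 0 := Nat.cast_ne_zero.mpr hh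
  rw [OnePointCurve.freeEnergy, residue_primitive_mul_omega1 hu, htwo]
  push_cast
  rw [show 2 - 2 * ((h : R) + 1) = -(2 * h) by ring]
  field_simp
  ring

theorem F_mul_prod_oddDoubleFactorial (hu : u ≠ 0) (g n : ℕ) (k : Fin (n + 1) → ℕ) :
    (painleveI u).F g k * ∏ i, oddDoubleFactorial (k i) =
      normalizedAmplitude u g (k 0) (List.ofFn fun i : Fin n => k i.succ : List ℕ) := by
  rw [OnePointCurve.F, if_neg (Nat.succ_ne_zero n), List.ofFn_succ,
    AiryTensors.amplitude_eq_headAmplitude (painleveI_airy_A_comm hu), normalizedAmplitude,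
    Fin.prod_univ_succ, Multiset.map_coe, Multiset.prod_coe, List.map_ofFn, List.prod_ofFn]
  rfl

end FreeEnergy

section MainTheorem

variable {u S : ℝ}

theorem normalizedAmplitude_le (hu : 0 < u) (hS : IsGrowthConstant u S) (g i : ℕ)
    (K : Multiset ℕ) (hst : 1 < 2 * g + K.card) :
    normalizedAmplitude u g i K ≤ S * growthBound u g (3 * g + (K.card + 1) - 3) := by
  have hV := isVirasoroSolution_normalizedAmplitude hu.ne'
  have hut : 6 * u * (1 / (6 * u)) = 1 := mul_one_div_cancel (by positivity)
  by_cases hsupp : 3 * g + K.card < i + K.sum + 2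
  · rw [hV.eq_zero_of_lt g i K hsupp]
    exact mul_nonneg hS.pos.le (growthBound_nonneg hu _ _)
  rcases g with _ | h
  · obtain ⟨c, hc⟩ : ∃ c, K.card = c + 2 := ⟨K.card - 2, by omega⟩
    obtain ⟨j, hj⟩ : ∃ j, i + K.sum + j = c := ⟨c - (i + K.sum), by omega⟩
    rw [show 3 * 0 + (K.card + 1) - 3 = c by omega]
    exact (hV.genus_zero_le hu hut i K c j hc hj).trans (hS.genus_zero_le c j (by omega))
  · obtain ⟨j, hj⟩ : ∃ j, i + K.sum + j = 3 * h + 1 + K.card :=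
      ⟨3 * h + 1 + K.card - (i + K.sum), by omega⟩
    rw [show 3 * (h + 1) + (K.card + 1) - 3 = 3 * h + (K.card + 1) by omega]
    exact (hV.positive_genus_le hu hut h i K j hj).trans
      (hS.ampBound_le h (K.card + 1) j (by omega))

theorem painleveI_freeEnergy_le (hu : 0 < u) (hS : IsGrowthConstant u S) {h : ℕ} (hh : h ≠ 0) :
    (painleveI u).freeEnergy (h + 1) ≤
      S * (8 / 5 * u * growthP u) * growthBound u (h + 1) (3 * h) := by
  have hP := growthP_pos hu
  have hpos := hS.pos
  have hG := growthBound_nonneg hu (h + 1) (3 * h)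
  have hh' : (1 : ℝ) ≤ h := by exact_mod_cast Nat.one_le_iff_ne_zero.mpr hh
  have hratio : 2 * u / (5 * h) * (3 * h + 1) ≤ 8 / 5 * u := by
    rw [div_mul_eq_mul_div, div_le_iff₀ (by positivity)]
    nlinarith
  have hone := normalizedAmplitude_le hu hS (h + 1) 1 0 (by rw [Multiset.card_zero]; omega)
  rw [Multiset.card_zero, show 3 * (h + 1) + (0 + 1) - 3 = 3 * h + 1 by omega,
    growthBound_succ] at hone
  rw [painleveI_freeEnergy_succ hu.ne' hh]
  calc 2 * u / (5 * h) * normalizedAmplitude u (h + 1) 1 0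
      ≤ 2 * u / (5 * h) *
        (S * (((3 * h : ℕ) + 1) * growthP u * growthBound u (h + 1) (3 * h))) := by gcongr
    _ = 2 * u / (5 * h) * (3 * h + 1) * (S * growthP u * growthBound u (h + 1) (3 * h)) := by
        push_cast
        ring
    _ ≤ 8 / 5 * u * (S * growthP u * growthBound u (h + 1) (3 * h)) := by gcongr
    _ = _ := by ring

theorem F_mul_prod_oddDoubleFactorial_le (hu : 0 < u) (hS : IsGrowthConstant u S) {g n : ℕ}
    (hst : 2 < 2 * g + n) (k : Fin n → ℕ) :
    (painleveI u).F g k * ∏ i, oddDoubleFactorial (k i) ≤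
      S * (1 + 8 / 5 * u * growthP u) * growthBound u g (3 * g + n - 3) := by
  have hP := growthP_pos hu
  have hG := growthBound_nonneg hu g (3 * g + n - 3)
  rcases n with _ | n
  · obtain ⟨h, rfl⟩ : ∃ h, g = h + 1 := ⟨g - 1, by omega⟩
    rw [OnePointCurve.F, if_pos rfl, Finset.univ_eq_empty, Finset.prod_empty, mul_one]
    refine (painleveI_freeEnergy_le hu hS (by omega)).trans ?_
    exact mul_le_mul_of_nonneg_right (mul_le_mul_of_nonneg_left (by linarith) hS.pos.le) hG
  · have hle := normalizedAmplitude_le hu hS g (k 0) (List.ofFn fun i : Fin n => k i.succ)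
      (by rw [Multiset.coe_card, List.length_ofFn]; omega)
    rw [Multiset.coe_card, List.length_ofFn] at hle
    rw [F_mul_prod_oddDoubleFactorial hu.ne']
    refine hle.trans (mul_le_mul_of_nonneg_right (le_mul_of_one_le_right hS.pos.le ?_) hG)
    exact le_add_of_nonneg_right (by positivity)

end MainTheorem

theorem mainTheorem6 :
    ∃ S : ℝ → ℝ, ∀ u : ℝ, 0 < u → 0 < S u ∧ 0 < growthP u ∧
      ∀ (g n : ℕ), 2 < 2 * g + n → ∀ k : Fin n → ℕ,
        (painleveI u).F g k * ∏ i, (((2 * k i + 1)‼ : ℕ) : ℝ) ≤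
          S u * (2 * u / 27) ^ g * growthP u ^ (3 * g + n - 3) *
            ((3 * g + n - 3).factorial / g.factorial : ℝ) := by
  choose! S hS using fun (u : ℝ) (hu : 0 < u) => exists_isGrowthConstant hu
  refine ⟨fun u => S u * (1 + 8 / 5 * u * growthP u), fun u hu => ?_⟩
  have hP := growthP_pos hu
  have hSu := (hS u hu).pos
  refine ⟨by positivity, hP, fun g n hst k => ?_⟩
  refine (F_mul_prod_oddDoubleFactorial_le hu (hS u hu) hst k).trans_eq ?_
  rw [growthBound]
  ring
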